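/- A partial field is a pair $\mathbb{P}=(R,G)$ of a commutative ring $R$ and a subgroup $G$ of its unit group with $-1\in G$. For disjoint finite sets $X,Y$, an $X\times Y$ matrix $A$ over $R$ is a $\mathbb{P}$-matrix if all its subdeterminants lie in $G\cup\{0\}$. For such $A$, let $M[A]$ be the matroid on $X\cup Y$ whose bases are $X$ and the sets $X\triangle Z$ with $|X\cap Z|=|Y\cap Z|$ and $\det A[X\cap Z,Y\cap Z]\neq 0$. A matroid is $\mathbb{P}$-representable if it is isomorphic to $M[A]$ for some $\mathbb{P}$-matrix $A$. It is ternary if it is representable over $(\mathrm{GF}(3),\mathrm{GF}(3)^*)$, and dyadic if it is representable over the dyadic partial field $\mathbb{D}=(\mathbb{Z}[\tfrac12],\langle -1,2\rangle)$. An excluded minor for the class of dyadic matroids is a finite matroid that is not dyadic but all of whose proper minors are dyadic. Let $N_4=M[A]$, where $A$ is the following matrix over $\mathrm{GF}(3)$: $$A=\begin{bmatrix} 1 & 0 & 1 & 1 & 1 & 1 & 2 & 1 \\ 0 & 2 & 0 & 0 & 1 & 0 & 0 & 1 \\ 1 & 0 & 2 & 1 & 0 & 1 & 2 & 1 \\ 1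 & 0 & 1 & 0 & 0 & 0 & 1 & 0 \\ 1 & 1 & 0 & 0 & 0 & 1 & 0 & 0 \\ 1 & 0 & 1 & 0 & 1 & 1 & 0 & 1 \\ 2 & 0 & 2 & 1 & 0 & 0 & 2 & 1 \\ 1 & 1 & 1 & 0 & 0 & 1 & 1 & 0 \end{bmatrix}$$ Then $N_4$ is a ternary matroid with $16$ elements and rank $8$, and $N_4$ is an excluded minor for the class of dyadic matroids. Consequently, if $\mathcal{L}$ is any collection of matroids each having at most $15$ elements (in particular, if $\mathcal{L}$ is the list of the excluded minors for dyadic matroids on at most $15$ elements), then $N_4$ is not isomorphic to a member of $\mathcal{L}$, and $\mathcal{L}$ does not contain, up to isomorphism, all excluded minors for the class of dyadic matroids. -/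

import Mathlib

/-! ### Partial fields -/

/-- A partial field `(R, G)`: a commutative ring `R` with a subgroup `G` of its group of units
that contains `-1`. -/
structure PartialField (R : Type*) [CommRing R] where
  /-- the group `G` -/
  group : Subgroup Rˣ
  neg_one_mem : (-1 : Rˣ) ∈ group

namespace PartialField

variable {R : Type*} [CommRing R]

/-- `x ∈ ℙ`, that is, `x ∈ G ∪ {0}`. -/
def Mem (P : PartialField R) (x : R) : Prop :=
  x = 0 ∨ ∃ u ∈ P.group, (u : R) = x

/-- `A` is a `ℙ`-matrix: every subdeterminant of `A` lies in `ℙ`.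
(The order in which the chosen rows and columns are listed only affects the sign.) -/
def IsPMatrix (P : PartialField R) {m n : Type*} (A : Matrix m n R) : Prop :=
  ∀ (k : ℕ) (f : Fin k ↪ m) (g : Fin k ↪ n), P.Mem (A.submatrix f g).det

/-- The partial field `(F, Fˣ)` of a field `F`. -/
def ofField (F : Type*) [Field F] : PartialField F where
  group := ⊤
  neg_one_mem := Subgroup.mem_top _

theorem ofField_isPMatrix {F : Type*} [Field F] {m n : Type*} (A : Matrix m n F) :
    (ofField F).IsPMatrix A := by
  intro k f g
  by_cases h : (A.submatrix f g).det = 0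
  · exact Or.inl h
  · exact Or.inr ⟨Units.mk0 _ h, Subgroup.mem_top _, rfl⟩

/-- The partial field `GF(3)`. -/
def gf3 : PartialField (ZMod 3) := ofField (ZMod 3)

/-- The element `2` as a unit of `ℤ[1/2]`. -/
noncomputable def twoUnit : (Localization.Away (2 : ℤ))ˣ :=
  (IsLocalization.Away.algebraMap_isUnit (S := Localization.Away (2 : ℤ)) (2 : ℤ)).unit

/-- The dyadic partial field `𝔻 = (ℤ[1/2], ⟨-1, 2⟩)`. -/
noncomputable def dyadic : PartialField (Localization.Away (2 : ℤ)) where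
  group := Subgroup.closure {-1, twoUnit}
  neg_one_mem := Subgroup.subset_closure (Set.mem_insert _ _)

end PartialField

/-! ### The matroid of a matrix over a partial field -/

/-- The family `{X} ∪ {X △ Z : |X ∩ Z| = |Y ∩ Z|, det A[X ∩ Z, Y ∩ Z] ≠ 0}` of an `X × Y` matrix
`A`, with `X` and `Y` as the two parts of `m ⊕ n`; the injections `f` and `g` list the elements of
`X ∩ Z` and `Y ∩ Z`. -/
def IsMatrixBase {R : Type*} [CommRing R] {m n : Type*} (A : Matrix m n R)
    (B : Set (m ⊕ n)) : Prop :=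
  B = Set.range Sum.inl ∨
    ∃ (k : ℕ) (f : Fin k ↪ m) (g : Fin k ↪ n), (A.submatrix f g).det ≠ 0 ∧
      B = symmDiff (Set.range Sum.inl) (Sum.inl '' Set.range f ∪ Sum.inr '' Set.range g)

namespace MatrixMatroid

/-- The columns of `[I | A]`. -/
def col {F : Type*} [Field F] {m n : Type*} [DecidableEq m] (A : Matrix m n F) :
    m ⊕ n → (m → F) :=
  Sum.elim (fun i => Pi.single i 1) (fun j i => A i j)

theorem symmDiff_eq {m n : Type*} {k : ℕ} (f : Fin k ↪ m) (g : Fin k ↪ n) :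
    symmDiff (Set.range Sum.inl) (Sum.inl '' Set.range f ∪ Sum.inr '' Set.range g)
      = Set.range (Sum.map (Subtype.val : {i // i ∉ Set.range f} → m) g) := by
  ext x
  rcases x with i | j <;> simp [Set.mem_symmDiff]

theorem linearIndepOn_iff_det {F : Type*} [Field F] {m n : Type*} [Fintype m] [DecidableEq m]
    (A : Matrix m n F) {k : ℕ} (f : Fin k ↪ m) (g : Fin k ↪ n) :
    LinearIndepOn F (col A)
      (symmDiff (Set.range Sum.inl) (Sum.inl '' Set.range f ∪ Sum.inr '' Set.range g))
      ↔ (A.submatrix f g).det ≠ 0 := by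
  classical
  rw [symmDiff_eq, linearIndepOn_range_iff
    (Function.Injective.sumMap Subtype.val_injective g.injective)]
  let e : {i // i ∉ Set.range f} ⊕ Fin k ≃ m :=
    ((Equiv.sumComm _ _).trans
      ((Equiv.ofInjective f f.injective).sumCongr (Equiv.refl _))).trans
      (Equiv.sumCompl (fun i => i ∈ Set.range f))
  have he1 : ∀ i, e (Sum.inl i) = i.1 := fun i => rfl
  have he2 : ∀ i, e (Sum.inr i) = f i := fun i => rfl
  let W : Matrix ({i // i ∉ Set.range f} ⊕ Fin k) ({i // i ∉ Set.range f} ⊕ Fin k) F :=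
    Matrix.fromBlocks 1 (A.submatrix Subtype.val g) 0 (A.submatrix f g)
  have hW : W.col = (LinearEquiv.funCongrLeft F F e) ∘
      (col A ∘ Sum.map (Subtype.val : {i // i ∉ Set.range f} → m) g) := by
    funext b a
    rcases b with b | b <;> rcases a with a | a
    · simp [W, Matrix.col, col, LinearEquiv.funCongrLeft_apply, LinearMap.funLeft, he1,
        Matrix.one_apply, Pi.single_apply, Subtype.ext_iff]
    · have : f a ≠ b.1 := fun h => b.2 ⟨a, h⟩
      simp [W, Matrix.col, col, LinearEquiv.funCongrLeft_apply, LinearMap.funLeft, he2,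
        this]
    · simp [W, Matrix.col, col, LinearEquiv.funCongrLeft_apply, LinearMap.funLeft, he1]
    · simp [W, Matrix.col, col, LinearEquiv.funCongrLeft_apply, LinearMap.funLeft, he2]
  have h1 : LinearIndependent F W.col ↔ LinearIndependent F
      (col A ∘ Sum.map (Subtype.val : {i // i ∉ Set.range f} → m) g) := by
    rw [hW]
    exact LinearMap.linearIndependent_iff_of_injOn
      (LinearEquiv.funCongrLeft F F e).toLinearMap
      (LinearEquiv.funCongrLeft F F e).injective.injOn
  rw [← h1, Matrix.linearIndependent_cols_iff_isUnit, Matrix.isUnit_iff_isUnit_det,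
    isUnit_iff_ne_zero, Matrix.det_fromBlocks_zero₂₁]
  simp

/-- Over a field, the family of `IsMatrixBase` consists of the sets of columns of `[I | A]` that
form a basis of the column space. -/
theorem isMatrixBase_iff {F : Type*} [Field F] {m n : Type*} [Fintype m] [DecidableEq m]
    [Finite n] (A : Matrix m n F) (B : Set (m ⊕ n)) :
    IsMatrixBase A B ↔ LinearIndepOn F (col A) B ∧ B.ncard = Fintype.card m := by
  classical
  have := Fintype.ofFinite n
  constructor
  · have key : ∀ (k : ℕ) (f : Fin k ↪ m) (g : Fin k ↪ n), (A.submatrix f g).det ≠ 0 →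
        B = symmDiff (Set.range Sum.inl) (Sum.inl '' Set.range f ∪ Sum.inr '' Set.range g) →
        LinearIndepOn F (col A) B ∧ B.ncard = Fintype.card m := by
      rintro k f g h rfl
      refine ⟨(linearIndepOn_iff_det A f g).2 h, ?_⟩
      rw [symmDiff_eq, ← Set.image_univ, Set.ncard_image_of_injective _
        (Function.Injective.sumMap Subtype.val_injective g.injective), Set.ncard_univ,
        Nat.card_sum, Nat.card_eq_fintype_card, Nat.card_eq_fintype_card, Fintype.card_fin,
        Fintype.card_subtype_compl (fun i => i ∈ Set.range f)]
      have h2 : Fintype.card {i // i ∈ Set.range f} = k := by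
        rw [← Fintype.card_congr (Equiv.ofInjective f f.injective), Fintype.card_fin]
      have h3 : k ≤ Fintype.card m := by
        simpa using Fintype.card_le_of_injective f f.injective
      rw [h2]
      omega
    rintro (rfl | ⟨k, f, g, h, hB⟩)
    · refine key 0 ⟨Fin.elim0, fun a => a.elim0⟩ ⟨Fin.elim0, fun a => a.elim0⟩ (by simp) ?_
      ext x
      simp [Set.mem_symmDiff]
    · exact key k f g h hB
  · rintro ⟨hli, hc⟩
    right
    have hcard : Fintype.card {j // Sum.inr j ∈ B} = Fintype.card {i // Sum.inl i ∉ B} := by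
      have h1 : B.ncard = Fintype.card {i // Sum.inl i ∈ B}
          + Fintype.card {j // Sum.inr j ∈ B} := by
        rw [← Nat.card_coe_set_eq, ← Fintype.card_sum, ← Nat.card_eq_fintype_card]
        exact Nat.card_congr Equiv.subtypeSum
      have h2 := Fintype.card_subtype_compl (fun i : m => Sum.inl i ∈ B)
      have h3 := Fintype.card_subtype_le (fun i : m => Sum.inl i ∈ B)
      omega
    let ef := (Fintype.equivFin {i // Sum.inl i ∉ B}).symm
    let eg := (Fintype.equivFinOfCardEq hcard).symm
    let f : Fin (Fintype.card {i // Sum.inl i ∉ B}) ↪ m :=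
      ef.toEmbedding.trans (Function.Embedding.subtype _)
    let g : Fin (Fintype.card {i // Sum.inl i ∉ B}) ↪ n :=
      eg.toEmbedding.trans (Function.Embedding.subtype _)
    have hf : Set.range f = {i | Sum.inl i ∉ B} := by
      ext i
      constructor
      · rintro ⟨a, rfl⟩
        exact (ef a).2
      · intro hi
        exact ⟨ef.symm ⟨i, hi⟩, by simp [f]⟩
    have hg : Set.range g = {j | Sum.inr j ∈ B} := by
      ext j
      constructor
      · rintro ⟨a, rfl⟩
        exact (eg a).2
      · intro hj
        exact ⟨eg.symm ⟨j, hj⟩, by simp [g]⟩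
    have hB : B = symmDiff (Set.range Sum.inl)
        (Sum.inl '' Set.range f ∪ Sum.inr '' Set.range g) := by
      rw [hf, hg]
      ext x
      rcases x with i | j <;> simp [Set.mem_symmDiff]
    refine ⟨_, f, g, ?_, hB⟩
    rw [← linearIndepOn_iff_det, ← hB]
    exact hli

theorem exchange_of_field {F : Type*} [Field F] {m n : Type*} [Finite m] [Finite n]
    (A : Matrix m n F) : Matroid.ExchangeProperty (IsMatrixBase A) := by
  classical
  have := Fintype.ofFinite m
  have := Fintype.ofFinite n
  intro B₁ B₂ h₁ h₂ e he
  rw [isMatrixBase_iff] at h₁ h₂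
  obtain ⟨hi₁, hc₁⟩ := h₁
  obtain ⟨hi₂, hc₂⟩ := h₂
  have hlt : (B₁ \ {e}).ncard < B₁.ncard := Set.ncard_sdiff_singleton_lt_of_mem he.1
  have hcc : (B₁ \ {e}).ncard + 1 = B₁.ncard := Set.ncard_sdiff_singleton_add_one he.1
  have hex : ∃ x ∈ B₂, col A x ∉ Submodule.span F (col A '' (B₁ \ {e})) := by
    by_contra! hcon
    have hle : Submodule.span F (col A '' B₂) ≤ Submodule.span F (col A '' (B₁ \ {e})) := by
      rw [Submodule.span_le]
      rintro _ ⟨x, hx, rfl⟩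
      exact hcon x hx
    have h3 := Submodule.finrank_mono hle
    have h4 : Module.finrank F (Submodule.span F (col A '' B₂)) = B₂.ncard := by
      rw [Set.image_eq_range, finrank_span_eq_card (b := fun x : B₂ => col A x) hi₂,
        ← Nat.card_eq_fintype_card, Nat.card_coe_set_eq]
    have h5 : Module.finrank F (Submodule.span F (col A '' (B₁ \ {e})))
        = (B₁ \ {e}).ncard := by
      rw [Set.image_eq_range, finrank_span_eq_card
        (b := fun x : (B₁ \ {e} : Set (m ⊕ n)) => col A x) (hi₁.mono Set.sdiff_subset),
        ← Nat.card_eq_fintype_card, Nat.card_coe_set_eq]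
    omega
  obtain ⟨x, hx₂, hx⟩ := hex
  have hx₀ : x ∉ B₁ \ {e} := fun h => hx (Submodule.subset_span ⟨x, h, rfl⟩)
  have hx₁ : x ∉ B₁ := by
    intro h
    refine hx₀ ⟨h, ?_⟩
    rintro rfl
    exact he.2 hx₂
  refine ⟨x, ⟨hx₂, hx₁⟩, (isMatrixBase_iff _ _).2
    ⟨(hi₁.mono Set.sdiff_subset).insert hx, ?_⟩⟩
  rw [Set.ncard_insert_of_notMem hx₀]
  omega

/-- The family of a matrix over a partial field satisfies the basis exchange axiom. -/
theorem exchange {R : Type*} [CommRing R] {m n : Type*} [Finite m] [Finite n]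
    (P : PartialField R) (A : Matrix m n R) (hA : P.IsPMatrix A) :
    Matroid.ExchangeProperty (IsMatrixBase A) := by
  rcases subsingleton_or_nontrivial R with hR | hR
  · intro B₁ B₂ h₁ h₂ e he
    have h : ∀ B, IsMatrixBase A B → B = Set.range Sum.inl := by
      rintro B (h | ⟨k, f, g, hd, -⟩)
      · exact h
      · exact absurd (Subsingleton.elim _ _) hd
    rw [h _ h₁, h _ h₂] at he
    exact absurd he.1 he.2
  · obtain ⟨I, hI⟩ := Ideal.exists_maximal R
    let _ := Ideal.Quotient.field I
    have h : IsMatrixBase A = IsMatrixBase (A.map (Ideal.Quotient.mk I)) := by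
      have hdet : ∀ (k : ℕ) (f : Fin k ↪ m) (g : Fin k ↪ n),
          (A.submatrix f g).det ≠ 0 ↔
            ((A.map (Ideal.Quotient.mk I)).submatrix f g).det ≠ 0 := by
        intro k f g
        have h1 : ((A.map (Ideal.Quotient.mk I)).submatrix f g).det
            = Ideal.Quotient.mk I (A.submatrix f g).det := by
          rw [RingHom.map_det]
          rfl
        rw [h1]
        rcases hA k f g with h0 | ⟨u, -, hu⟩
        · simp [h0]
        · rw [← hu]
          exact iff_of_true u.ne_zero (u.isUnit.map (Ideal.Quotient.mk I)).ne_zero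
      funext B
      simp only [IsMatrixBase, hdet]
    rw [h]
    exact exchange_of_field _

end MatrixMatroid

/-- The matroid `M[A]` of an `X × Y` matrix `A` over a partial field `ℙ`, on the ground set
`X ∪ Y`. Its bases are the sets in the family `IsMatrixBase A`. -/
def matrixMatroid {R : Type*} [CommRing R] {m n : Type*} [Finite m] [Finite n]
    (P : PartialField R) (A : Matrix m n R) (hA : P.IsPMatrix A) : Matroid (m ⊕ n) :=
  Matroid.ofIsBaseOfFinite (E := Set.univ) Set.finite_univ (IsMatrixBase A)
    ⟨_, Or.inl rfl⟩ (MatrixMatroid.exchange P A hA) (fun _ _ => Set.subset_univ _)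

/-! ### Representable matroids and excluded minors -/

/-- Isomorphism of matroids: a bijection of the ground sets that preserves bases and non-bases. -/
def MatroidIso {α β : Type*} (M : Matroid α) (N : Matroid β) : Prop :=
  ∃ e : M.E ≃ N.E, ∀ B : Set M.E,
    M.IsBase (Subtype.val '' B) ↔ N.IsBase (Subtype.val '' (e '' B))

/-- `M` is `ℙ`-representable: `M ≅ M[A]` for some (finite) `ℙ`-matrix `A`. -/
def IsRepresentableOver {R : Type*} [CommRing R] (P : PartialField R) {α : Type*}
    (M : Matroid α) : Prop :=
  ∃ (p q : ℕ) (A : Matrix (Fin p) (Fin q) R) (hA : P.IsPMatrix A),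
    MatroidIso M (matrixMatroid P A hA)

/-- `M` is dyadic: representable over the dyadic partial field. -/
def IsDyadic {α : Type*} (M : Matroid α) : Prop :=
  IsRepresentableOver PartialField.dyadic M

/-- `M` is an excluded minor for the class of dyadic matroids: `M` is a finite matroid that is not
dyadic, and every proper minor of `M` is dyadic. -/
def IsDyadicExcludedMinor {α : Type*} (M : Matroid α) : Prop :=
  M.Finite ∧ ¬ IsDyadic M ∧ ∀ N : Matroid α, N <m M → IsDyadic N

/-! ### The matroid `N₄` -/

/-- The reduced `GF(3)`-representation of `N₄`. -/
def matrixN₄ : Matrix (Fin 8) (Fin 8) (ZMod 3) :=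
  !![1, 0, 1, 1, 1, 1, 2, 1;
     0, 2, 0, 0, 1, 0, 0, 1;
     1, 0, 2, 1, 0, 1, 2, 1;
     1, 0, 1, 0, 0, 0, 1, 0;
     1, 1, 0, 0, 0, 1, 0, 0;
     1, 0, 1, 0, 1, 1, 0, 1;
     2, 0, 2, 1, 0, 0, 2, 1;
     1, 1, 1, 0, 0, 1, 1, 0]

/-- The matroid `N₄`. -/
def N₄ : Matroid (Fin 8 ⊕ Fin 8) :=
  matrixMatroid PartialField.gf3 matrixN₄ (PartialField.ofField_isPMatrix matrixN₄)

/-! Why `N₄` is not dyadic. Scale a matrix with the same vanishing subdeterminants as `matrixN₄`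
along a spanning tree of nonzero entries. Vanishing minors of order 2 and 3 then express the entries
that matter through a single parameter x = `A 6 3`; in particular `A 2 2` becomes 1/x. The block on
rows and columns 5, 6, 7 has determinant -x(x + 1), and the block on rows and columns 0, ..., 4 has
determinant 1/x - 2. Both vanish over GF(3), so x = -1 and x = 1/2, which forces 3 = 0
(`not_sameZeroMinors_matrixN₄`). A dyadic representation would map to such a matrix over GF(5).

Why proper minors are dyadic. Each of the two values of x satisfies one of the two conditions: up to
scaling, `liftOne` is the case x = -1 and `liftTwo` the case x = 1/2. For each lift, all maximal
minors of [I | A] but one are zero or signed powers of two, hence lie in the dyadic partial field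
and vanish exactly when they vanish modulo 3. The exception, of absolute value 3, is the 5 × 5 block
(the set `halfOne`) for `liftOne` and the 3 × 3 block (the set `halfTwo`) for `liftTwo`. The bases
of a minor `(M ／ C) ＼ D` correspond to the bases of `M` that contain `C` and avoid `D`. If one half
fails to contain `C` or meets `D`, the corresponding lift represents the minor
(`isDyadic_minor_of_lift`). Since the halves are complementary, otherwise `C` and `D` are both empty
and the minor is not proper.

The claim about maximal minors is a finite computation, done by fraction-free pivoting on powers of
two (`MinorCheck.checkExcept`). -/

/-! ### Integers that are zero or a power of two up to sign -/

/-- `x` is zero or, up to sign, a power of two. -/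
def IsSignedPowTwo (x : ℤ) : Prop := x = 0 ∨ ∃ k : ℕ, x.natAbs = 2 ^ k

theorem IsSignedPowTwo.mul {x y : ℤ} (hx : IsSignedPowTwo x) (hy : IsSignedPowTwo y) :
    IsSignedPowTwo (x * y) := by
  rcases hx with rfl | ⟨a, ha⟩
  · left; simp
  rcases hy with rfl | ⟨b, hb⟩
  · left; simp
  exact Or.inr ⟨a + b, by rw [Int.natAbs_mul, ha, hb, pow_add]⟩

theorem IsSignedPowTwo.of_mul_left {x y : ℤ} (hx : x ≠ 0) (h : IsSignedPowTwo (x * y)) :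
    IsSignedPowTwo y := by
  rcases h with h | ⟨k, hk⟩
  · exact Or.inl ((mul_eq_zero.1 h).resolve_left hx)
  · rw [Int.natAbs_mul] at hk
    obtain ⟨j, -, hj⟩ := (Nat.dvd_prime_pow Nat.prime_two).1 (Dvd.intro_left _ hk)
    exact Or.inr ⟨j, hj⟩

theorem isSignedPowTwo_neg_one_pow (n : ℕ) : IsSignedPowTwo ((-1) ^ n) :=
  Or.inr ⟨0, by simp [Int.natAbs_pow]⟩

theorem IsSignedPowTwo.zsmul_unit {x : ℤ} (u : ℤˣ) (h : IsSignedPowTwo x) :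
    IsSignedPowTwo (u • x) := by
  rcases h with rfl | ⟨k, hk⟩
  · left; simp
  · exact Or.inr ⟨k, by rw [Units.smul_def, smul_eq_mul, Int.natAbs_mul, Int.units_natAbs, hk,
      one_mul]⟩

/-- Pivoting: the determinant in terms of the Schur complement of the entry `(0, i)`. -/
theorem Matrix.det_pivot_row_zero {R : Type*} [CommRing R] {r : ℕ}
    (M : Matrix (Fin (r + 1)) (Fin (r + 1)) R) (i : Fin (r + 1)) :
    M 0 i ^ r * M.det = (-1) ^ (i : ℕ) * M 0 i *
      (Matrix.of fun a b : Fin r =>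
        M 0 i * M a.succ (i.succAbove b) - M a.succ i * M 0 (i.succAbove b)).det := by
  set p := M 0 i with hp
  -- Every row except row 0 is multiplied by the pivot `p`, which contributes `p ^ r`; subtracting
  -- multiples of row 0 then clears column `i` below the pivot without any division.
  let v : Fin (r + 1) → R := Fin.cons 1 fun _ => p
  let N : Matrix (Fin (r + 1)) (Fin (r + 1)) R :=
    Matrix.of fun a b => v a * M a b + (Fin.cons 0 fun a : Fin r => - M a.succ i : _ → R) a * M 0 b
  have h1 : N.det = p ^ r * M.det := by
    have h2 : N.det = (Matrix.of fun a b => v a * M a b).det := by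
      refine Matrix.det_eq_of_forall_row_eq_smul_add_const
        (Fin.cons 0 fun a : Fin r => - M a.succ i) 0 (by simp) ?_
      intro a b
      simp [N, v]
    rw [h2, Matrix.det_mul_column]
    simp [v, Fin.prod_univ_succ]
  rw [← h1, Matrix.det_succ_column N i, Fin.sum_univ_succ, Finset.sum_eq_zero]
  · have h3 : N 0 i = p := by simp [N, v, hp]
    rw [h3, add_zero, Fin.val_zero, zero_add]
    congr 2
    ext a b
    simp [N, v, sub_eq_add_neg]
  · intro a _
    have : N a.succ i = 0 := by simp [N, v, ← hp]; ring
    rw [this]; ring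

/-! ### A terminating check of all maximal minors -/

/-- The determinant of the `r × r` matrix with the given rows. -/
def listDet (r : ℕ) (l : List (List ℤ)) : ℤ :=
  (Matrix.of fun i j : Fin r => (l.getD i []).getD j 0).det

namespace MinorCheck

/-- Evaluate an integer before passing it on. -/
def forceInt {β : Type} (x : ℤ) (k : ℤ → β) : β :=
  match x with
  | .ofNat 0 => k (.ofNat 0)
  | .ofNat (n + 1) => k (.ofNat (n + 1))
  | .negSucc 0 => k (.negSucc 0)
  | .negSucc (n + 1) => k (.negSucc (n + 1))

/-- Evaluate a list of integers before passing it on. -/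
def forceList {β : Type} : List ℤ → (List ℤ → β) → β
  | [], k => k []
  | x :: l, k => forceInt x fun x' => forceList l fun l' => k (x' :: l')

/-- Evaluate a list of lists of integers before passing it on. -/
def forceLists {β : Type} : List (List ℤ) → (List (List ℤ) → β) → β
  | [], k => k []
  | x :: l, k => forceList x fun x' => forceLists l fun l' => k (x' :: l')

@[simp] theorem forceInt_eq {β : Type} (x : ℤ) (k : ℤ → β) : forceInt x k = k x := by
  unfold forceInt; split <;> rfl

@[simp] theorem forceList_eq {β : Type} (l : List ℤ) (k : List ℤ → β) : forceList l k = k l := by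
  induction l generalizing k with
  | nil => rfl
  | cons x l ih => simp [forceList, ih]

@[simp] theorem forceLists_eq {β : Type} (l : List (List ℤ)) (k : List (List ℤ) → β) :
    forceLists l k = k l := by
  induction l generalizing k with
  | nil => rfl
  | cons x l ih => simp [forceLists, ih]

/-- Test whether `n` is one of the first powers of two. -/
def isPow : ℕ → ℕ → Bool
  | 0, _ => false
  | fuel + 1, n => n == 1 || (n % 2 == 0 && isPow fuel (n / 2))

theorem exists_pow_of_isPow {fuel n : ℕ} (h : isPow fuel n = true) : ∃ k, n = 2 ^ k := by
  induction fuel generalizing n with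
  | zero => simp [isPow] at h
  | succ fuel ih =>
    simp only [isPow, Bool.or_eq_true, beq_iff_eq, Bool.and_eq_true] at h
    rcases h with rfl | ⟨h1, h2⟩
    · exact ⟨0, rfl⟩
    · obtain ⟨k, hk⟩ := ih h2
      exact ⟨k + 1, by rw [pow_succ]; omega⟩

/-- Eliminate coordinate `i` from the vector `d` with the pivot vector `c`. -/
def reduce (c : List ℤ) (i : ℕ) (d : List ℤ) : List ℤ :=
  forceInt (c.getD i 0) fun p => forceInt (d.getD i 0) fun q =>
    (List.zipWith (fun x y => p * x - q * y) d c).eraseIdx i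

/-- A coordinate of `c` to pivot on. -/
def pivot (c : List ℤ) : ℕ :=
  match c.findIdx? (fun x => x.natAbs == 1) with
  | some i => i
  | none => c.findIdx (fun x => x != 0)

/-- Check that every `r × r` determinant whose rows form a sublist of `cs` is zero or a signed
power of two. -/
def check : ℕ → ℕ → List (List ℤ) → Bool
  | 0, _, _ => false
  | _ + 1, 0, _ => true
  | _ + 1, _ + 1, [] => true
  | fuel + 1, r + 1, c :: cs =>
    -- Fewer than `r + 1` vectors remain, so there is nothing to test. Otherwise the minors split
    -- into those without `c` and those with `c`; the latter are treated by pivoting.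
    decide (cs.length < r) ||
    (check fuel (r + 1) cs &&
      (c.all (· == 0) ||
        (decide (pivot c < r + 1) && (isPow 64 (c.getD (pivot c) 0).natAbs &&
          (r == 0 || forceLists (cs.map (reduce c (pivot c))) fun cs' => check fuel r cs')))))

/-- The same check, but the first `r` elements of `cs` are exempted. -/
def checkExcept : ℕ → List (List ℤ) → Bool
  | 0, _ => true
  | _ + 1, [] => true
  | r + 1, c :: cs =>
    -- Each recursive call of `check` discards a vector, so for 16 vectors fuel 20 is enough;
    -- running out of fuel returns `false` and cannot affect soundness. For `r = 0` the only
    -- remaining set containing `c` is the exempted one.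
    check 20 (r + 1) cs && (r == 0 || (decide (pivot c < r + 1) &&
      (isPow 64 (c.getD (pivot c) 0).natAbs &&
        forceLists (cs.map (reduce c (pivot c))) fun cs' => checkExcept r cs')))

theorem length_reduce {r : ℕ} {c d : List ℤ} {i : ℕ} (hc : c.length = r + 1)
    (hd : d.length = r + 1) (hi : i < r + 1) : (reduce c i d).length = r := by
  rw [reduce, forceInt_eq, forceInt_eq, List.length_eraseIdx]
  simp [hc, hd, hi]

theorem getD_reduce {r : ℕ} {c d : List ℤ} (hc : c.length = r + 1)
    (hd : d.length = r + 1) (i : Fin (r + 1)) (b : Fin r) :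
    (reduce c i d).getD b 0 = c.getD i 0 * d.getD (i.succAbove b) 0
      - d.getD i 0 * c.getD (i.succAbove b) 0 := by
  have hb := b.2
  have hi := i.2
  rw [reduce, forceInt_eq, forceInt_eq, List.getD_eq_getElem?_getD, List.getElem?_eraseIdx]
  by_cases h : (b : ℕ) < i
  · have hs : ((i.succAbove b : Fin (r + 1)) : ℕ) = b := by
      rw [Fin.succAbove_of_castSucc_lt _ _ h]; rfl
    rw [hs, if_pos h, List.getElem?_zipWith, List.getElem?_eq_getElem (by omega),
      List.getElem?_eq_getElem (by omega)]
    rw [List.getD_eq_getElem d (n := b) 0 (by omega), List.getD_eq_getElem c (n := b) 0 (by omega)]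
    rfl
  · have hs : ((i.succAbove b : Fin (r + 1)) : ℕ) = b + 1 := by
      rw [Fin.succAbove_of_le_castSucc _ _ (Fin.le_def.2 (by simpa using h))]; rfl
    rw [hs, if_neg h, List.getElem?_zipWith, List.getElem?_eq_getElem (by omega),
      List.getElem?_eq_getElem (by omega)]
    rw [List.getD_eq_getElem d (n := b + 1) 0 (by omega),
      List.getD_eq_getElem c (n := b + 1) 0 (by omega)]
    rfl

theorem listDet_cons {r : ℕ} {c : List ℤ} {l : List (List ℤ)} (hl : l.length = r)
    (hc : c.length = r + 1) (hd : ∀ d ∈ l, d.length = r + 1) {i : ℕ} (hi : i < r + 1) :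
    c.getD i 0 ^ r * listDet (r + 1) (c :: l)
      = (-1) ^ i * c.getD i 0 * listDet r (l.map (reduce c i)) := by
  have := Matrix.det_pivot_row_zero
    (Matrix.of fun i j : Fin (r + 1) => ((c :: l).getD i []).getD j 0) ⟨i, hi⟩
  simp only [Matrix.of_apply, Fin.val_zero, List.getD_cons_zero, Fin.val_succ,
    List.getD_cons_succ] at this
  rw [listDet, this, listDet]
  congr 2
  ext a b
  have ha : (a : ℕ) < l.length := by omega
  have h1 : (l.map (reduce c i)).getD a [] = reduce c i (l.getD a []) := by
    rw [List.getD_eq_getElem _ _ (by simpa using ha), List.getD_eq_getElem _ _ ha,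
      List.getElem_map]
  rw [Matrix.of_apply, Matrix.of_apply, h1]
  refine (getD_reduce hc (hd _ ?_) ⟨i, hi⟩ b).symm
  rw [List.getD_eq_getElem _ _ ha]
  exact List.getElem_mem _

theorem listDet_cons_of_all_zero {r : ℕ} {c : List ℤ} {l : List (List ℤ)}
    (h : c.all (· == 0) = true) : listDet (r + 1) (c :: l) = 0 := by
  refine Matrix.det_eq_zero_of_row_eq_zero 0 fun j => ?_
  simp only [List.all_eq_true, beq_iff_eq] at h
  by_cases hj : (j : ℕ) < c.length
  · simpa [hj] using h _ (List.getElem_mem hj)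
  · simp [List.getElem?_eq_none (not_lt.1 hj)]

/-- The pivot identity puts a nonzero power of the pivot on the left and one factor of the pivot on
the right. When the pivot is a signed power of two, the class of zero and signed powers of two
passes from the reduced determinant to the original one. -/
theorem isSignedPowTwo_listDet_cons {r : ℕ} {c : List ℤ} {l : List (List ℤ)} (hl : l.length = r)
    (hc : c.length = r + 1) (hd : ∀ d ∈ l, d.length = r + 1) {i : ℕ} (hi : i < r + 1)
    (hp : isPow 64 (c.getD i 0).natAbs = true)
    (h : IsSignedPowTwo (listDet r (l.map (reduce c i)))) :
    IsSignedPowTwo (listDet (r + 1) (c :: l)) := by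
  obtain ⟨k, hk⟩ := exists_pow_of_isPow hp
  have h0 : c.getD i 0 ≠ 0 := by
    intro h0
    rw [h0] at hk
    exact absurd hk.symm (by simp)
  refine IsSignedPowTwo.of_mul_left (pow_ne_zero r h0) ?_
  rw [listDet_cons hl hc hd hi]
  exact ((isSignedPowTwo_neg_one_pow i).mul (Or.inr ⟨k, hk⟩)).mul h

theorem isSignedPowTwo_of_check {fuel r : ℕ} {cs : List (List ℤ)} (h : check fuel r cs = true)
    (hcs : ∀ d ∈ cs, d.length = r) {l : List (List ℤ)} (hl : l.Sublist cs) (hr : l.length = r) :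
    IsSignedPowTwo (listDet r l) := by
  induction fuel generalizing r cs l with
  | zero => simp [check] at h
  | succ fuel ih =>
    rcases r with _ | r
    · exact Or.inr ⟨0, by simp [listDet]⟩
    rcases cs with _ | ⟨c, cs⟩
    · rw [List.sublist_nil.1 hl] at hr
      simp at hr
    simp only [check, Bool.or_eq_true, Bool.and_eq_true, decide_eq_true_eq, beq_iff_eq,
      forceLists_eq] at h
    have hlen := hl.length_le
    simp only [List.length_cons] at hlen
    rcases h with h | ⟨h1, h2⟩
    · omega
    rw [List.sublist_cons_iff] at hl
    rcases hl with hl | ⟨l, rfl, hl⟩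
    · exact ih h1 (fun d hd => hcs d (List.mem_cons_of_mem _ hd)) hl hr
    rcases h2 with h2 | ⟨hi, hp, h2⟩
    · exact Or.inl (listDet_cons_of_all_zero h2)
    have hr' : l.length = r := by simpa using hr
    have hd : ∀ d ∈ cs, d.length = r + 1 := fun d hd => hcs d (List.mem_cons_of_mem _ hd)
    have hc : c.length = r + 1 := hcs c List.mem_cons_self
    refine isSignedPowTwo_listDet_cons hr' hc (fun d h => hd d (hl.subset h)) hi hp ?_
    rcases h2 with rfl | h2
    · exact Or.inr ⟨0, by simp [listDet]⟩
    refine ih h2 ?_ (hl.map _) (by simpa using hr')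
    intro d h
    obtain ⟨d, h', rfl⟩ := List.mem_map.1 h
    exact length_reduce hc (hd d h') hi

/-- The sublists are taken of labels `L`, with vectors attached by `c`, because distinct labels may
carry equal vectors after a reduction; the exempted set is only well defined in terms of labels. -/
theorem isSignedPowTwo_of_checkExcept {r : ℕ} {cs : List (List ℤ)}
    (h : checkExcept r cs = true) (hcs : ∀ d ∈ cs, d.length = r) {ι : Type*} {c : ι → List ℤ}
    {L l : List ι} (hL : L.map c = cs) (hl : l.Sublist L) (hr : l.length = r)
    (hne : l ≠ L.take r) :
    IsSignedPowTwo (listDet r (l.map c)) := by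
  induction r generalizing cs c L l with
  | zero =>
    exact Or.inr ⟨0, by simp [listDet]⟩
  | succ r ih =>
    rcases L with _ | ⟨x, L⟩
    · rw [List.sublist_nil.1 hl] at hr
      simp at hr
    subst hL
    simp only [List.map_cons, checkExcept, Bool.and_eq_true, Bool.or_eq_true, decide_eq_true_eq,
      beq_iff_eq, forceLists_eq] at h
    obtain ⟨h1, h2⟩ := h
    have hd : ∀ d ∈ L.map c, d.length = r + 1 := fun d hd => hcs d (List.mem_cons_of_mem _ hd)
    have hc : (c x).length = r + 1 := hcs _ List.mem_cons_self
    rw [List.sublist_cons_iff] at hl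
    rcases hl with hl | ⟨l, rfl, hl⟩
    · exact isSignedPowTwo_of_check h1 hd (hl.map c) (by simpa using hr)
    have hr' : l.length = r := by simpa using hr
    rw [List.map_cons]
    rcases h2 with rfl | ⟨hi, hp, h2⟩
    · exact absurd (by simp [List.length_eq_zero_iff.1 hr']) hne
    refine isSignedPowTwo_listDet_cons (by simpa using hr') hc
      (fun d h => hd d ((hl.map c).subset h)) hi hp ?_
    rw [List.map_map]
    refine ih h2 ?_ (c := reduce (c x) (pivot (c x)) ∘ c) (List.map_map ..).symm hl hr' ?_
    · intro d h
      obtain ⟨d, h', rfl⟩ := List.mem_map.1 h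
      exact length_reduce hc (hd d h') hi
    · rintro rfl
      exact hne rfl

end MinorCheck

/-! ### Two integer lifts of the matrix of `N₄` -/

/-- The columns of `[I | A]` over a commutative ring. -/
def identityCol {R : Type*} [CommRing R] {m n : Type*} [DecidableEq m] (A : Matrix m n R) :
    m ⊕ n → m → R :=
  Sum.elim (fun i => Pi.single i 1) (fun j i => A i j)

/-- The lift of `matrixN₄` with entries `0, 1, -1`. -/
def liftOne : Matrix (Fin 8) (Fin 8) ℤ :=
  !![1, 0, 1, 1, 1, 1, -1, 1;
     0, -1, 0, 0, 1, 0, 0, 1;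
     1, 0, -1, 1, 0, 1, -1, 1;
     1, 0, 1, 0, 0, 0, 1, 0;
     1, 1, 0, 0, 0, 1, 0, 0;
     1, 0, 1, 0, 1, 1, 0, 1;
     -1, 0, -1, 1, 0, 0, -1, 1;
     1, 1, 1, 0, 0, 1, 1, 0]

/-- A lift of `matrixN₄` that uses `2`. -/
def liftTwo : Matrix (Fin 8) (Fin 8) ℤ :=
  !![1, 0, 1, 1, 1, 1, 2, 1;
     0, -1, 0, 0, 1, 0, 0, 1;
     1, 0, 2, 1, 0, 1, 2, 1;
     1, 0, 1, 0, 0, 0, 1, 0;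
     1, 1, 0, 0, 0, 1, 0, 0;
     1, 0, 1, 0, 1, 1, 0, 1;
     2, 0, 2, 1, 0, 0, 2, 1;
     1, 1, 1, 0, 0, 1, 1, 0]

/-- The first of two complementary halves of the ground set. -/
def halfOne : List (Fin 8 ⊕ Fin 8) :=
  [.inl 5, .inl 6, .inl 7, .inr 0, .inr 1, .inr 2, .inr 3, .inr 4]

/-- The second of two complementary halves of the ground set. -/
def halfTwo : List (Fin 8 ⊕ Fin 8) :=
  [.inl 0, .inl 1, .inl 2, .inl 3, .inl 4, .inr 5, .inr 6, .inr 7]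

theorem checkExcept_liftOne :
    MinorCheck.checkExcept 8
      [[0, 0, 0, 0, 0, 1, 0, 0], [0, 0, 0, 0, 0, 0, 1, 0], [0, 0, 0, 0, 0, 0, 0, 1],
       [1, 0, 1, 1, 1, 1, -1, 1], [0, -1, 0, 0, 1, 0, 0, 1], [1, 0, -1, 1, 0, 1, -1, 1],
       [1, 0, 1, 0, 0, 0, 1, 0], [1, 1, 0, 0, 0, 1, 0, 0], [1, 0, 0, 0, 0, 0, 0, 0],
       [0, 1, 0, 0, 0, 0, 0, 0], [0, 0, 1, 0, 0, 0, 0, 0], [0, 0, 0, 1, 0, 0, 0, 0],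
       [0, 0, 0, 0, 1, 0, 0, 0], [1, 0, 1, 0, 1, 1, 0, 1], [-1, 0, -1, 1, 0, 0, -1, 1],
       [1, 1, 1, 0, 0, 1, 1, 0]] = true := by
  decide +kernel

theorem checkExcept_liftTwo :
    MinorCheck.checkExcept 8
      [[1, 0, 0, 0, 0, 0, 0, 0], [0, 1, 0, 0, 0, 0, 0, 0], [0, 0, 1, 0, 0, 0, 0, 0],
       [0, 0, 0, 1, 0, 0, 0, 0], [0, 0, 0, 0, 1, 0, 0, 0], [1, 0, 1, 0, 1, 1, 0, 1],
       [2, 0, 2, 1, 0, 0, 2, 1], [1, 1, 1, 0, 0, 1, 1, 0], [0, 0, 0, 0, 0, 1, 0, 0],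
       [0, 0, 0, 0, 0, 0, 1, 0], [0, 0, 0, 0, 0, 0, 0, 1], [1, 0, 1, 1, 1, 1, 2, 1],
       [0, -1, 0, 0, 1, 0, 0, 1], [1, 0, 2, 1, 0, 1, 2, 1], [1, 0, 1, 0, 0, 0, 1, 0],
       [1, 1, 0, 0, 0, 1, 0, 0]] = true := by
  decide +kernel

/-! ### Representing a minor by the maximal minors of a larger matrix -/

open scoped Matroid

namespace PartialField

variable {R : Type*} [CommRing R] (P : PartialField R)

theorem Mem.of_mul_right {P : PartialField R} {x y : R} (hy : P.Mem y) (hy0 : y ≠ 0)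
    (h : P.Mem (x * y)) : P.Mem x := by
  obtain ⟨u, hu, rfl⟩ := hy.resolve_left hy0
  rcases h with h | ⟨v, hv, h⟩
  · exact Or.inl ((u.isUnit.mul_left_eq_zero).1 h)
  · refine Or.inr ⟨v * u⁻¹, P.group.mul_mem hv (P.group.inv_mem hu), ?_⟩
    rw [Units.val_mul, h, mul_assoc, Units.mul_inv, mul_one]

end PartialField

/-- The rows outside the range of `φ` are unit vectors, so the matrix is block triangular with an
identity block. This turns a maximal minor of [I | A] into a subdeterminant of A. -/
theorem Matrix.det_extend_single {R ι κ : Type*} [CommRing R] [Fintype ι] [DecidableEq ι]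
    [Fintype κ] [DecidableEq κ] (φ : κ ↪ ι) (V : κ → ι → R) :
    (Matrix.of (Function.extend φ V fun i => Pi.single i 1)).det
      = (Matrix.of fun a b => V a (φ b)).det := by
  classical
  set N := Matrix.of (Function.extend φ V fun i => Pi.single i (1 : R)) with hN
  have hrow : ∀ i, i ∉ Set.range φ → N i = Pi.single i 1 := fun i hi =>
    Function.extend_apply' V (fun i => Pi.single i (1 : R)) i hi
  rw [Matrix.twoBlockTriangular_det N (fun i => i ∈ Set.range φ)]
  · have h1 : N.toSquareBlockProp (fun i => i ∉ Set.range φ) = 1 := by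
      ext i j
      rw [Matrix.toSquareBlockProp_def, Matrix.of_apply, hrow _ i.2, Matrix.one_apply,
        Pi.single_apply]
      simp only [Subtype.ext_iff, eq_comm]
    rw [h1, Matrix.det_one, mul_one]
    have h2 := Matrix.det_submatrix_equiv_self (Equiv.ofInjective φ φ.injective)
      (N.toSquareBlockProp (fun i => i ∈ Set.range φ))
    have h3 : (N.toSquareBlockProp (fun i => i ∈ Set.range φ)).submatrix
        (Equiv.ofInjective φ φ.injective) (Equiv.ofInjective φ φ.injective)
        = Matrix.of fun a b => V a (φ b) := by
      ext a b
      simp [Matrix.toSquareBlockProp_def, N, φ.injective.extend_apply]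
    rw [h3] at h2
    rw [h2]
    convert rfl
  · intro i hi j hj
    rw [hrow i hi, Pi.single_apply, if_neg]
    rintro rfl
    exact hi hj

theorem exists_symmDiff_eq {m n : Type*} [Fintype m] [Finite n] (B : Set (m ⊕ n))
    (hc : B.ncard = Fintype.card m) :
    ∃ (k : ℕ) (f : Fin k ↪ m) (g : Fin k ↪ n),
      B = symmDiff (Set.range Sum.inl) (Sum.inl '' Set.range f ∪ Sum.inr '' Set.range g) := by
  classical
  have := Fintype.ofFinite n
  have hcard : Fintype.card {j // Sum.inr j ∈ B} = Fintype.card {i // Sum.inl i ∉ B} := by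
    have h1 : B.ncard = Fintype.card {i // Sum.inl i ∈ B}
        + Fintype.card {j // Sum.inr j ∈ B} := by
      rw [← Nat.card_coe_set_eq, ← Fintype.card_sum, ← Nat.card_eq_fintype_card]
      exact Nat.card_congr Equiv.subtypeSum
    have h2 := Fintype.card_subtype_compl (fun i : m => Sum.inl i ∈ B)
    have h3 := Fintype.card_subtype_le (fun i : m => Sum.inl i ∈ B)
    omega
  let ef := (Fintype.equivFin {i // Sum.inl i ∉ B}).symm
  let eg := (Fintype.equivFinOfCardEq hcard).symm
  refine ⟨_, ef.toEmbedding.trans (Function.Embedding.subtype _),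
    eg.toEmbedding.trans (Function.Embedding.subtype _), ?_⟩
  have hf : Set.range (ef.toEmbedding.trans (Function.Embedding.subtype _))
      = {i | Sum.inl i ∉ B} := by
    ext i
    exact ⟨fun ⟨a, h⟩ => h ▸ (ef a).2, fun hi => ⟨ef.symm ⟨i, hi⟩, by simp⟩⟩
  have hg : Set.range (eg.toEmbedding.trans (Function.Embedding.subtype _))
      = {j | Sum.inr j ∈ B} := by
    ext j
    exact ⟨fun ⟨a, h⟩ => h ▸ (eg a).2, fun hj => ⟨eg.symm ⟨j, hj⟩, by simp⟩⟩
  rw [hf, hg]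
  ext x
  rcases x with i | j <;> simp [Set.mem_symmDiff]

@[simp] theorem matrixMatroid_ground {R : Type*} [CommRing R] {m n : Type*} [Finite m] [Finite n]
    (P : PartialField R) (A : Matrix m n R) (hA : P.IsPMatrix A) :
    (matrixMatroid P A hA).E = Set.univ := rfl

@[simp] theorem matrixMatroid_isBase_iff {R : Type*} [CommRing R] {m n : Type*} [Finite m]
    [Finite n] (P : PartialField R) (A : Matrix m n R) (hA : P.IsPMatrix A) {B : Set (m ⊕ n)} :
    (matrixMatroid P A hA).IsBase B ↔ IsMatrixBase A B := Iff.rfl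

/-- A matroid on a whole type is isomorphic to its image under an injection. -/
theorem matroidIso_of_injective {α β : Type*} {M : Matroid α} {N : Matroid β}
    (hN : N.E = Set.univ) (s : β → α) (hs : Function.Injective s) (hr : Set.range s = M.E)
    (h : ∀ S : Set β, N.IsBase S ↔ M.IsBase (s '' S)) : MatroidIso M N := by
  let e : β ≃ M.E := (Equiv.ofInjective s hs).trans (Equiv.setCongr hr)
  have he : ∀ b, (e b : α) = s b := fun b => rfl
  refine ⟨e.symm.trans ((Equiv.Set.univ β).symm.trans (Equiv.setCongr hN.symm)), fun B => ?_⟩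
  rw [h]
  have : s '' (Subtype.val '' ((e.symm.trans
      ((Equiv.Set.univ β).symm.trans (Equiv.setCongr hN.symm))) '' B)) = Subtype.val '' B := by
    rw [Set.image_image, Set.image_image]
    refine Set.image_congr fun x _ => ?_
    change s (e.symm x) = x
    rw [← he, Equiv.apply_symm_apply]
  rw [this]

/-- The base `B₀` witnesses that `D` is coindependent and that `C` is independent in `M ＼ D`, so
neither operation changes the rank unexpectedly. -/
theorem Matroid.contract_delete_isBase_iff {α : Type*} {M : Matroid α} {C D B₀ : Set α}
    (hB₀ : M.IsBase B₀) (hC : C ⊆ B₀) (hD : Disjoint B₀ D) (X : Set α) :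
    ((M ／ C) ＼ D).IsBase X ↔ M.IsBase (X ∪ C) ∧ Disjoint X C ∧ Disjoint X D := by
  have hCD : Disjoint C D := hD.mono_left hC
  have hco : M.Coindep (D ∩ M.E) := by
    rw [Matroid.coindep_iff_exists (Set.inter_subset_right)]
    exact ⟨B₀, hB₀, Set.subset_sdiff.2 ⟨hB₀.subset_ground, hD.mono_right Set.inter_subset_left⟩⟩
  have hdel : ∀ B, (M ＼ D).IsBase B ↔ M.IsBase B ∧ Disjoint B D := by
    intro B
    rw [← Matroid.delete_inter_ground_eq, hco.delete_isBase_iff]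
    refine and_congr_right fun hB => ?_
    have := hB.subset_ground
    simp only [Set.disjoint_left, Set.mem_inter_iff, not_and]
    exact forall₂_congr fun x hx => ⟨fun h hD => h hD (this hx), fun h hD => absurd hD h⟩
  have hI : (M ＼ D).Indep C := Matroid.delete_indep_iff.2 ⟨hB₀.indep.subset hC, hCD⟩
  rw [Matroid.contract_delete_comm _ hCD, hI.contract_isBase_iff, hdel, Set.disjoint_union_left]
  tauto

/-- Let the rows of `W` represent the bases of `M` that contain `C` and avoid `D`. Then the minor
`M ／ C ＼ D` is representable. -/
theorem isRepresentableOver_minor {R : Type*} [CommRing R] [Nontrivial R] (P : PartialField R)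
    {α ι : Type*} [Fintype ι] [DecidableEq ι] {M : Matroid α} (hE : M.E.Finite) {C D : Set α}
    (W : α → ι → R) (b₀ : ι → α) (hb₀ : Function.Injective b₀) (hB₀ : M.IsBase (Set.range b₀))
    (hC : C ⊆ Set.range b₀) (hD : Disjoint (Set.range b₀) D)
    (hP : ∀ b : ι → α, Function.Injective b → Set.range b ⊆ M.E → C ⊆ Set.range b →
      Disjoint (Set.range b) D → P.Mem (Matrix.of (W ∘ b)).det ∧
        (M.IsBase (Set.range b) ↔ (Matrix.of (W ∘ b)).det ≠ 0)) :
    IsRepresentableOver P ((M ／ C) ＼ D) := by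
  classical
  obtain ⟨hT, hT0⟩ := hP b₀ hb₀ hB₀.subset_ground hC hD
  replace hT0 := hT0.1 hB₀
  set T := Matrix.of (W ∘ b₀) with hTdef
  have hTu : IsUnit T.det := by
    obtain ⟨u, -, hu⟩ := hT.resolve_left hT0
    exact hu ▸ u.isUnit
  -- Change coordinates so that the base `b₀` becomes the standard basis. All maximal minors are
  -- divided by the unit `T.det`, which lies in the group of `P`.
  let V : α → ι → R := fun x => Matrix.vecMul (W x) T⁻¹
  have hV : ∀ b : ι → α, (Matrix.of (V ∘ b)).det * T.det = (Matrix.of (W ∘ b)).det := by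
    intro b
    rw [← Matrix.det_mul]
    congr 1
    have : Matrix.of (V ∘ b) = Matrix.of (W ∘ b) * T⁻¹ := by
      ext i j; rfl
    rw [this, Matrix.mul_assoc, Matrix.nonsing_inv_mul _ hTu, Matrix.mul_one]
  have hV0 : ∀ i, V (b₀ i) = Pi.single i 1 := by
    intro i
    have : T * T⁻¹ = 1 := Matrix.mul_nonsing_inv _ hTu
    ext j
    have := congr_fun (congr_fun this i) j
    rw [Matrix.one_apply] at this
    rw [Pi.single_apply]
    simp only [eq_comm (a := j)]
    rw [← this]
    rfl
  have hfin : Finite ↑(M.E \ (D ∪ Set.range b₀)) := hE.subset Set.sdiff_subset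
  have := Fintype.ofFinite ↑(M.E \ (D ∪ Set.range b₀))
  let ep := (Fintype.equivFin {i : ι // b₀ i ∉ C}).symm
  let eq := (Fintype.equivFin ↑(M.E \ (D ∪ Set.range b₀))).symm
  set p := Fintype.card {i : ι // b₀ i ∉ C}
  set q := Fintype.card ↑(M.E \ (D ∪ Set.range b₀))
  -- Rows are the elements of the base outside `C`, columns the surviving elements outside the base.
  -- The coordinates belonging to `C` can be dropped because only sets containing `C` matter.
  let A : Matrix (Fin p) (Fin q) R := fun i j => V (eq j) (ep i)
  let φ : ∀ {k : ℕ}, (Fin k ↪ Fin p) → (Fin k ↪ ι) := fun f =>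
    (f.trans ep.toEmbedding).trans (Function.Embedding.subtype _)
  -- The exchanged set: the base elements indexed by `f` are replaced by the elements indexed by
  -- `g`, and everything in `C` is kept.
  let bb : ∀ {k : ℕ}, (Fin k ↪ Fin p) → (Fin k ↪ Fin q) → ι → α := fun f g =>
    Function.extend (φ f) (fun a => (eq (g a) : α)) b₀
  have hdet : ∀ {k : ℕ} (f : Fin k ↪ Fin p) (g : Fin k ↪ Fin q),
      (A.submatrix f g).det * T.det = (Matrix.of (W ∘ bb f g)).det := by
    intro k f g
    rw [← hV (bb f g)]
    congr 1
    have h1 : V ∘ bb f g = Function.extend (φ f) (fun a => V (eq (g a)))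
        (fun i => Pi.single i 1) := by
      simp only [bb]
      have h2 : (fun i => Pi.single i 1) = V ∘ b₀ := funext fun i => (hV0 i).symm
      rw [h2]
      exact funext (Function.apply_extend V (φ f) b₀)
    rw [h1, Matrix.det_extend_single, ← Matrix.det_transpose]
    rfl
  have hrange : ∀ {k : ℕ} (f : Fin k ↪ Fin p) (g : Fin k ↪ Fin q),
      Set.range (bb f g) = Set.range (fun a => (eq (g a) : α)) ∪ b₀ '' (Set.range (φ f))ᶜ :=
    fun f g => Set.range_extend (φ f).injective _ _
  have hbinj : ∀ {k : ℕ} (f : Fin k ↪ Fin p) (g : Fin k ↪ Fin q),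
      Function.Injective (bb f g) := by
    intro k f g i j hij
    by_cases hi : ∃ a, φ f a = i <;> by_cases hj : ∃ a, φ f a = j
    · obtain ⟨a, rfl⟩ := hi
      obtain ⟨c, rfl⟩ := hj
      simp only [bb, (φ f).injective.extend_apply] at hij
      rw [g.injective (eq.injective (Subtype.val_injective hij))]
    · obtain ⟨a, rfl⟩ := hi
      simp only [bb, (φ f).injective.extend_apply, Function.extend_apply' _ _ _ hj] at hij
      exact absurd (Or.inr ⟨j, hij.symm⟩) (eq (g a)).2.2
    · obtain ⟨a, rfl⟩ := hj
      simp only [bb, (φ f).injective.extend_apply, Function.extend_apply' _ _ _ hi] at hij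
      exact absurd (Or.inr ⟨i, hij⟩) (eq (g a)).2.2
    · simp only [bb, Function.extend_apply' _ _ _ hi, Function.extend_apply' _ _ _ hj] at hij
      exact hb₀ hij
  have hcond : ∀ {k : ℕ} (f : Fin k ↪ Fin p) (g : Fin k ↪ Fin q),
      P.Mem (Matrix.of (W ∘ bb f g)).det ∧
        (M.IsBase (Set.range (bb f g)) ↔ (Matrix.of (W ∘ bb f g)).det ≠ 0) := by
    intro k f g
    refine hP _ (hbinj f g) ?_ ?_ ?_ <;> rw [hrange]
    · rintro x (⟨a, rfl⟩ | ⟨i, -, rfl⟩)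
      · exact (eq (g a)).2.1
      · exact hB₀.subset_ground ⟨i, rfl⟩
    · intro x hx
      obtain ⟨i, rfl⟩ := hC hx
      refine Or.inr ⟨i, ?_, rfl⟩
      rintro ⟨a, rfl⟩
      exact (ep (f a)).2 hx
    · rw [Set.disjoint_left]
      rintro x (⟨a, rfl⟩ | ⟨i, -, rfl⟩) hx
      · exact (eq (g a)).2.2 (Or.inl hx)
      · exact Set.disjoint_left.1 hD ⟨i, rfl⟩ hx
  have hA : P.IsPMatrix A := by
    intro k f g
    refine PartialField.Mem.of_mul_right hT hT0 ?_
    rw [hdet]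
    exact (hcond f g).1
  have hbase : ∀ {k : ℕ} (f : Fin k ↪ Fin p) (g : Fin k ↪ Fin q),
      M.IsBase (Set.range (bb f g)) ↔ (A.submatrix f g).det ≠ 0 := by
    intro k f g
    rw [(hcond f g).2, ← hdet, not_iff_not, hTu.mul_left_eq_zero]
  let s : Fin p ⊕ Fin q → α := Sum.elim (fun i => b₀ (ep i)) (fun j => eq j)
  have hs : Function.Injective s := by
    refine Function.Injective.sumElim (hb₀.comp (Subtype.val_injective.comp ep.injective))
      (Subtype.val_injective.comp eq.injective) fun i j h => (eq j).2.2 (Or.inr ⟨_, h⟩)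
  have hsE : Set.range s = ((M ／ C) ＼ D).E := by
    rw [Matroid.delete_ground, Matroid.contract_ground, Set.Sum.elim_range]
    ext x
    constructor
    · rintro (⟨i, rfl⟩ | ⟨j, rfl⟩)
      · exact ⟨⟨hB₀.subset_ground ⟨_, rfl⟩, (ep i).2⟩, Set.disjoint_left.1 hD ⟨_, rfl⟩⟩
      · exact ⟨⟨(eq j).2.1, fun h => (eq j).2.2 (Or.inr (hC h))⟩, fun h => (eq j).2.2 (Or.inl h)⟩
    · rintro ⟨⟨hx, hxC⟩, hxD⟩
      by_cases h : x ∈ Set.range b₀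
      · obtain ⟨i, rfl⟩ := h
        exact Or.inl ⟨ep.symm ⟨i, hxC⟩, by simp⟩
      · exact Or.inr ⟨eq.symm ⟨x, hx, by simp [hxD, not_exists.1 h]⟩, by simp⟩
  have hsC : ∀ S, Disjoint (s '' S) C := by
    intro S
    refine Set.disjoint_left.2 ?_
    rintro _ ⟨i | j, -, rfl⟩ h
    · exact (ep i).2 h
    · exact (eq j).2.2 (Or.inr (hC h))
  have hsD : ∀ S, Disjoint (s '' S) D := by
    intro S
    refine Set.disjoint_left.2 ?_
    rintro _ ⟨i | j, -, rfl⟩ h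
    · exact Set.disjoint_left.1 hD ⟨_, rfl⟩ h
    · exact (eq j).2.2 (Or.inl h)
  have hsym : ∀ {k : ℕ} (f : Fin k ↪ Fin p) (g : Fin k ↪ Fin q),
      s '' symmDiff (Set.range Sum.inl) (Sum.inl '' Set.range f ∪ Sum.inr '' Set.range g) ∪ C
        = Set.range (bb f g) := by
    intro k f g
    rw [hrange]
    ext x
    constructor
    · rintro (⟨i | j, h, rfl⟩ | hx)
      · refine Or.inr ⟨ep i, ?_, rfl⟩
        rintro ⟨a, ha⟩
        have hia : f a = i := ep.injective (Subtype.val_injective ha)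
        simp [Set.mem_symmDiff, ← hia] at h
      · simp only [Set.mem_symmDiff, Set.mem_range, reduceCtorEq, exists_false, Set.mem_union,
          Set.mem_image, Sum.inr.injEq, and_false, exists_eq_right, false_or, false_and,
          not_false_eq_true, and_true] at h
        obtain ⟨a, rfl⟩ := h
        exact Or.inl ⟨a, rfl⟩
      · obtain ⟨i, rfl⟩ := hC hx
        refine Or.inr ⟨i, ?_, rfl⟩
        rintro ⟨a, rfl⟩
        exact (ep (f a)).2 hx
    · rintro (⟨a, rfl⟩ | ⟨i, hi, rfl⟩)
      · exact Or.inl ⟨Sum.inr (g a), by simp [Set.mem_symmDiff], rfl⟩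
      · by_cases h : b₀ i ∈ C
        · exact Or.inr h
        · refine Or.inl ⟨Sum.inl (ep.symm ⟨i, h⟩), ?_, by simp [s]⟩
          simp only [Set.mem_symmDiff, Set.mem_range, Sum.inl.injEq, exists_eq, Set.mem_union,
            Set.mem_image, exists_eq_right, reduceCtorEq, and_false, exists_false, or_false,
            true_and, not_true_eq_false, not_exists]
          intro a ha
          exact hi ⟨a, by simp [φ, ha]⟩
  have hinl : s '' Set.range Sum.inl ∪ C = Set.range b₀ := by
    ext x
    constructor
    · rintro (⟨_, ⟨i, rfl⟩, rfl⟩ | hx)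
      · exact ⟨_, rfl⟩
      · exact hC hx
    · rintro ⟨i, rfl⟩
      by_cases h : b₀ i ∈ C
      · exact Or.inr h
      · exact Or.inl ⟨_, ⟨ep.symm ⟨i, h⟩, rfl⟩, by simp [s]⟩
  refine ⟨p, q, A, hA, matroidIso_of_injective rfl s hs hsE fun S => ?_⟩
  rw [Matroid.contract_delete_isBase_iff hB₀ hC hD, matrixMatroid_isBase_iff]
  simp only [hsC, hsD, and_true]
  constructor
  · rintro (rfl | ⟨k, f, g, h, rfl⟩)
    · rwa [hinl]
    · rwa [hsym, hbase]
  · intro h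
    have hcS : S.ncard = Fintype.card (Fin p) := by
      have h1 := h.ncard_eq_ncard_of_isBase hB₀
      have hCf : C.Finite := (Set.finite_range b₀).subset hC
      rw [← hinl, Set.ncard_union_eq (hsC _) (Set.toFinite _) hCf,
        Set.ncard_union_eq (hsC _) (Set.toFinite _) hCf, Set.ncard_image_of_injective _ hs,
        Set.ncard_image_of_injective _ hs, ← Set.image_univ,
        Set.ncard_image_of_injective _ Sum.inl_injective, Set.ncard_univ,
        Nat.card_eq_fintype_card] at h1
      omega
    obtain ⟨k, f, g, rfl⟩ := exists_symmDiff_eq S hcS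
    rw [hsym, hbase] at h
    exact Or.inr ⟨k, f, g, h, rfl⟩

/-! ### Integer lifts, reduction modulo 3 and the dyadic partial field -/

theorem isMatrixBase_range_iff {F : Type*} [Field F] {m n : Type*} [Fintype m] [DecidableEq m]
    [Finite n] (A : Matrix m n F) (b : m → m ⊕ n) (hb : Function.Injective b) :
    IsMatrixBase A (Set.range b) ↔ (Matrix.of (identityCol A ∘ b)).det ≠ 0 := by
  have h1 : (Set.range b).ncard = Fintype.card m := by
    rw [← Set.image_univ, Set.ncard_image_of_injective _ hb, Set.ncard_univ,
      Nat.card_eq_fintype_card]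
  have h2 : LinearIndependent F (MatrixMatroid.col A ∘ b)
      ↔ LinearIndependent F (Matrix.of (identityCol A ∘ b)).row := Iff.rfl
  rw [MatrixMatroid.isMatrixBase_iff, linearIndepOn_range_iff hb, h2,
    Matrix.linearIndependent_rows_iff_isUnit, Matrix.isUnit_iff_isUnit_det, isUnit_iff_ne_zero]
  simp [h1]

theorem identityCol_map {R S : Type*} [CommRing R] [CommRing S] {m n : Type*} [DecidableEq m]
    (φ : R →+* S) (A : Matrix m n R) (x : m ⊕ n) :
    identityCol (A.map φ) x = φ ∘ identityCol A x := by
  rcases x with i | j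
  · ext a
    by_cases h : a = i <;> simp [identityCol, h]
  · rfl

theorem det_identityCol_map {R S : Type*} [CommRing R] [CommRing S] {m n : Type*} [DecidableEq m]
    [Fintype m] (φ : R →+* S) (A : Matrix m n R) (b : m → m ⊕ n) :
    (Matrix.of (identityCol (A.map φ) ∘ b)).det = φ (Matrix.of (identityCol A ∘ b)).det := by
  rw [RingHom.map_det]
  congr 1
  ext i j
  simp [identityCol_map]

theorem algebraMap_localization_two_injective :
    Function.Injective (algebraMap ℤ (Localization.Away (2 : ℤ))) :=
  IsLocalization.injective _ (powers_le_nonZeroDivisors_of_noZeroDivisors (two_ne_zero (α := ℤ)))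

instance nontrivial_localization_two : Nontrivial (Localization.Away (2 : ℤ)) :=
  algebraMap_localization_two_injective.nontrivial

theorem dyadic_mem_of_isSignedPowTwo {x : ℤ} (h : IsSignedPowTwo x) :
    PartialField.dyadic.Mem (algebraMap ℤ (Localization.Away (2 : ℤ)) x) := by
  rcases h with rfl | ⟨k, hk⟩
  · exact Or.inl (map_zero _)
  right
  have h2 : PartialField.twoUnit ^ k ∈ PartialField.dyadic.group :=
    pow_mem (Subgroup.subset_closure (by simp)) k
  have h3 : ((PartialField.twoUnit ^ k : (Localization.Away (2 : ℤ))ˣ) : Localization.Away (2 : ℤ))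
      = algebraMap ℤ _ (2 ^ k) := by
    rw [Units.val_pow_eq_pow_val, map_pow]; rfl
  rcases Int.natAbs_eq x with h | h <;> rw [hk] at h
  · exact ⟨_, h2, by rw [h3, h]; norm_cast⟩
  · refine ⟨-1 * PartialField.twoUnit ^ k,
      mul_mem PartialField.dyadic.neg_one_mem h2, ?_⟩
    rw [Units.val_mul, h3, h]
    simp

/-- A power of two is not divisible by 3. Hence an integer lift defines the same bases over GF(3)
and over ℤ[1/2] wherever its minors are of this form. -/
theorem IsSignedPowTwo.zmod_three_ne_zero_iff {x : ℤ} (h : IsSignedPowTwo x) :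
    (x : ZMod 3) ≠ 0 ↔ algebraMap ℤ (Localization.Away (2 : ℤ)) x ≠ 0 := by
  have hinj : Function.Injective (algebraMap ℤ (Localization.Away (2 : ℤ))) :=
    algebraMap_localization_two_injective
  rw [map_ne_zero_iff _ hinj]
  rcases h with rfl | ⟨k, hk⟩
  · simp
  have h0 : x ≠ 0 := by
    rintro rfl
    exact absurd hk.symm (by simp)
  refine iff_of_true (fun h => ?_) h0
  have h3 : (3 : ℕ) ∣ x.natAbs := Int.natCast_dvd.1 ((ZMod.intCast_zmod_eq_zero_iff_dvd x 3).1 h)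
  rw [hk] at h3
  exact absurd (Nat.prime_three.dvd_of_dvd_pow h3) (by norm_num)

/-- Any injective choice `b` of vectors is a reordering of a sublist of `L`, and reordering changes
the determinant only by a sign. -/
theorem isSignedPowTwo_det_of_checkExcept {n : Type*} [DecidableEq n] {r : ℕ}
    (A : Matrix (Fin r) n ℤ) (L : List (Fin r ⊕ n)) (hL : ∀ x, x ∈ L) (hnd : L.Nodup)
    (h : MinorCheck.checkExcept r (L.map fun x => List.ofFn (identityCol A x)) = true)
    (b : Fin r → Fin r ⊕ n) (hb : Function.Injective b)
    (hne : Set.range b ≠ {x | x ∈ L.take r}) :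
    IsSignedPowTwo (Matrix.of (identityCol A ∘ b)).det := by
  classical
  set l := L.filter (fun x => x ∈ Set.range b) with hl
  have hmem : ∀ x, x ∈ l ↔ x ∈ Set.range b := fun x => by simp [hl, hL]
  have hlnd : l.Nodup := hnd.filter _
  let e : Fin r ≃ {x // x ∈ l} :=
    (Equiv.ofInjective b hb).trans (Equiv.subtypeEquivRight fun x => (hmem x).symm)
  have hlen : l.length = r := by
    simpa using Fintype.card_congr ((List.Nodup.getEquiv l hlnd).trans e.symm)
  let σ : Fin r ≃ Fin r := (e.trans (List.Nodup.getEquiv l hlnd).symm).trans (finCongr hlen)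
  have hσ : ∀ i, l[(σ i : ℕ)]'(by omega) = b i := by
    intro i
    have : ((List.Nodup.getEquiv l hlnd) ((List.Nodup.getEquiv l hlnd).symm (e i)) : Fin r ⊕ n)
      = b i := by rw [Equiv.apply_symm_apply]; rfl
    exact this
  have hdet := MinorCheck.isSignedPowTwo_of_checkExcept h ?_ rfl
    (List.filter_sublist (p := fun x => x ∈ Set.range b)) hlen (fun h => hne ?_)
  rotate_left
  · intro d hd
    obtain ⟨x, -, rfl⟩ := List.mem_map.1 hd
    exact List.length_ofFn
  · ext x
    rw [← hmem, hl, h]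
    rfl
  · have h2 : Matrix.of (identityCol A ∘ b) = (Matrix.of fun i j : Fin r =>
        ((l.map fun x => List.ofFn (identityCol A x)).getD i []).getD j 0).submatrix σ id := by
      ext i j
      have : (σ i : ℕ) < l.length := by omega
      simp [this, hσ]
    rw [h2, Matrix.det_permute]
    exact hdet.zsmul_unit (Equiv.Perm.sign σ)

/-- If the minors of a lift of `matrixN₄` are dyadic apart from one, then minors of `N₄` that do
not involve the exceptional minor are dyadic. -/
theorem isDyadic_minor_of_lift (A : Matrix (Fin 8) (Fin 8) ℤ)
    (hA : A.map (Int.castRingHom (ZMod 3)) = matrixN₄) {S C D B₀ : Set (Fin 8 ⊕ Fin 8)}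
    (hS : ∀ b : Fin 8 → Fin 8 ⊕ Fin 8, Function.Injective b → Set.range b ≠ S →
      IsSignedPowTwo (Matrix.of (identityCol A ∘ b)).det)
    (hB₀ : N₄.IsBase B₀) (hC : C ⊆ B₀) (hD : Disjoint B₀ D)
    (hCDS : C ⊆ S → ¬ Disjoint S D) : IsDyadic ((N₄ ／ C) ＼ D) := by
  have hcard : B₀.ncard = Fintype.card (Fin 8) :=
    ((MatrixMatroid.isMatrixBase_iff _ _).1 hB₀).2
  obtain ⟨b₀, hb₀, rfl⟩ : ∃ b₀ : Fin 8 → Fin 8 ⊕ Fin 8, Function.Injective b₀ ∧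
      Set.range b₀ = B₀ := by
    have e : B₀ ≃ Fin 8 := by
      classical
      refine Fintype.equivFinOfCardEq ?_
      rw [← Nat.card_eq_fintype_card, Nat.card_coe_set_eq, hcard]
      rfl
    refine ⟨fun i => e.symm i, Subtype.val_injective.comp e.symm.injective, ?_⟩
    change Set.range (Subtype.val ∘ e.symm) = B₀
    rw [e.symm.surjective.range_comp, Subtype.range_coe]
  refine isRepresentableOver_minor PartialField.dyadic (Set.toFinite _)
    (identityCol (A.map (algebraMap ℤ (Localization.Away (2 : ℤ))))) b₀ hb₀ hB₀ hC hD ?_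
  intro b hb _ hCb hDb
  have hp : IsSignedPowTwo (Matrix.of (identityCol A ∘ b)).det :=
    hS b hb (by rintro rfl; exact hCDS hCb hDb)
  rw [det_identityCol_map]
  refine ⟨dyadic_mem_of_isSignedPowTwo hp, ?_⟩
  rw [← hp.zmod_three_ne_zero_iff]
  refine (isMatrixBase_range_iff matrixN₄ b hb).trans ?_
  rw [← hA, det_identityCol_map]
  exact Iff.rfl

/-! ### Proper minors of N₄ -/

/-- Every minor is obtained by contracting part of a base and deleting part of its complement. -/
theorem Matroid.IsMinor.exists_isBase {α : Type*} {M N : Matroid α} (h : N ≤m M) :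
    ∃ C D B : Set α, M.IsBase B ∧ C ⊆ B ∧ Disjoint B D ∧ N = (M ／ C) ＼ D := by
  obtain ⟨C, D, hC, hD, hCD, rfl⟩ := h.exists_eq_contract_delete_disjoint
  obtain ⟨I, hI⟩ := M.exists_isBasis C
  -- Once a basis `I` of `C` is contracted, the rest of `C` consists of loops, which may be deleted
  -- instead.
  rw [hI.contract_eq_contract_delete, Matroid.delete_delete]
  set X := C \ I ∪ D with hX
  have hXE : X ⊆ (M ／ I).E := by
    rw [Matroid.contract_ground]
    refine Set.union_subset (Set.sdiff_subset_sdiff_left hC) ?_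
    exact Set.subset_sdiff.2 ⟨hD, (hCD.mono_left hI.subset).symm⟩
  set M' := M ／ I with hM'
  obtain ⟨J, hJ⟩ := M'.exists_isBasis (M'.E \ X)
  obtain ⟨B, hB, rfl⟩ := hJ.exists_isBase
  have hK := hB.inter_isBasis_iff_compl_inter_isBasis_dual.1 hJ
  rw [Set.sdiff_sdiff_cancel_left hXE] at hK
  set K := (M'.E \ B) ∩ X with hKdef
  -- The dual of the previous step: `K` is a basis of `X` in the dual, so after deleting `K` the
  -- rest of `X` consists of coloops, which may be contracted instead.
  have hdel : M' ＼ X = (M' ＼ K) ／ (X \ K) := by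
    have := congr_arg Matroid.dual hK.contract_eq_contract_delete
    rwa [Matroid.dual_contract_dual, Matroid.dual_contract_delete, Matroid.dual_dual] at this
  have hB' := (hI.indep.contract_isBase_iff).1 hB
  have hLB : X \ K ⊆ B := by
    intro x hx
    by_contra hxB
    exact hx.2 ⟨⟨hXE hx.1, hxB⟩, hx.1⟩
  refine ⟨I ∪ X \ K, K, B ∪ I, hB'.1, ?_, ?_, ?_⟩
  · exact Set.union_subset Set.subset_union_right (hLB.trans Set.subset_union_left)
  · refine Set.disjoint_union_left.2 ⟨?_, ?_⟩
    · exact Set.disjoint_left.2 fun x hx hxK => hxK.1.2 hx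
    · exact Set.disjoint_left.2 fun x hx hxK => hxK.1.1.2 hx
  · rw [hdel, ← Matroid.contract_contract, ← hM',
      M'.contract_delete_comm Set.disjoint_sdiff_left]

theorem isSignedPowTwo_det_liftOne (b : Fin 8 → Fin 8 ⊕ Fin 8) (hb : Function.Injective b)
    (hne : Set.range b ≠ {x | x ∈ halfOne}) :
    IsSignedPowTwo (Matrix.of (identityCol liftOne ∘ b)).det := by
  refine isSignedPowTwo_det_of_checkExcept liftOne (halfOne ++ halfTwo)
    (Sum.forall.2 (by simp [halfOne, halfTwo]; decide)) (by decide)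
    ?_ b hb hne
  rw [← checkExcept_liftOne]
  congr 1

theorem isSignedPowTwo_det_liftTwo (b : Fin 8 → Fin 8 ⊕ Fin 8) (hb : Function.Injective b)
    (hne : Set.range b ≠ {x | x ∈ halfTwo}) :
    IsSignedPowTwo (Matrix.of (identityCol liftTwo ∘ b)).det := by
  refine isSignedPowTwo_det_of_checkExcept liftTwo (halfTwo ++ halfOne)
    (Sum.forall.2 (by simp [halfOne, halfTwo]; decide)) (by decide)
    ?_ b hb hne
  rw [← checkExcept_liftTwo]
  congr 1

theorem isDyadic_of_isStrictMinor_N₄ {N : Matroid (Fin 8 ⊕ Fin 8)} (h : N <m N₄) :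
    IsDyadic N := by
  obtain ⟨C, D, B₀, hB₀, hC, hD, rfl⟩ := h.isMinor.exists_isBase
  have hone := isDyadic_minor_of_lift liftOne (by decide +kernel) isSignedPowTwo_det_liftOne
    hB₀ hC hD
  have htwo := isDyadic_minor_of_lift liftTwo (by decide +kernel) isSignedPowTwo_det_liftTwo
    hB₀ hC hD
  have hhalf : ∀ x, x ∈ halfOne ↔ x ∉ halfTwo := Sum.forall.2 (by simp [halfOne, halfTwo]; decide)
  by_contra hcon
  have h1 : C ⊆ {x | x ∈ halfOne} ∧ Disjoint {x | x ∈ halfOne} D := by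
    by_contra h
    exact hcon (hone fun h1 h2 => h ⟨h1, h2⟩)
  have h2 : C ⊆ {x | x ∈ halfTwo} ∧ Disjoint {x | x ∈ halfTwo} D := by
    by_contra h
    exact hcon (htwo fun h1 h2 => h ⟨h1, h2⟩)
  -- Neither lift applies, so `C` lies in both halves and `D` misses both; the halves partition the
  -- ground set.
  have hC0 : C = ∅ := Set.eq_empty_of_forall_notMem fun x hx =>
    (hhalf x).1 (h1.1 hx) (h2.1 hx)
  have hD0 : D = ∅ := Set.eq_empty_of_forall_notMem fun x hx => by
    by_cases hx1 : x ∈ halfOne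
    · exact Set.disjoint_left.1 h1.2 hx1 hx
    · exact Set.disjoint_left.1 h2.2 (not_not.1 (mt (hhalf x).2 hx1)) hx
  refine h.ne ?_
  rw [hC0, hD0, Matroid.contract_empty, Matroid.delete_empty]

/-! ### N₄ is not dyadic -/

/-- A matrix matroid over a field that is representable over a partial field `(R, G)` is given by
a matrix with the same vanishing subdeterminants over every field to which `R` maps. -/
theorem exists_matrix_of_isRepresentableOver {R F K : Type*} [CommRing R] [Field F] [Field K]
    {P : PartialField R} (φ : R →+* F) {m n : Type*} [Fintype m] [Finite n] (A₀ : Matrix m n K)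
    {P₀ : PartialField K} {hA₀ : P₀.IsPMatrix A₀}
    (h : IsRepresentableOver P (matrixMatroid P₀ A₀ hA₀)) :
    ∃ A : Matrix m n F, ∀ (k : ℕ) (f : Fin k ↪ m) (g : Fin k ↪ n),
      (A.submatrix f g).det ≠ 0 ↔ (A₀.submatrix f g).det ≠ 0 := by
  classical
  obtain ⟨p, q, A, hA, e, he⟩ := h
  let s : m ⊕ n → Fin p ⊕ Fin q := fun x => (e ⟨x, Set.mem_univ x⟩).1
  have hs : Function.Injective s := fun x y h =>
    congr_arg Subtype.val (e.injective (Subtype.val_injective h))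
  have hφ : IsMatrixBase A = IsMatrixBase (A.map φ) := by
    have hdet : ∀ (k : ℕ) (f : Fin k ↪ Fin p) (g : Fin k ↪ Fin q),
        (A.submatrix f g).det ≠ 0 ↔ ((A.map φ).submatrix f g).det ≠ 0 := by
      intro k f g
      have h1 : ((A.map φ).submatrix f g).det = φ (A.submatrix f g).det := by
        rw [RingHom.map_det]
        rfl
      rw [h1]
      rcases hA k f g with h0 | ⟨u, -, hu⟩
      · simp [h0]
      · have := φ.domain_nontrivial
        rw [← hu]
        exact iff_of_true u.ne_zero (u.isUnit.map φ).ne_zero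
    funext B
    simp only [IsMatrixBase, hdet]
  -- The given representation, pushed to `F` and relabelled along the isomorphism; its own
  -- distinguished base need not correspond to `m`, so a change of basis follows.
  let v : m ⊕ n → Fin p → F := MatrixMatroid.col (A.map φ) ∘ s
  have hv : ∀ B : Set (m ⊕ n), IsMatrixBase A₀ B ↔ LinearIndepOn F v B ∧ B.ncard = p := by
    intro B
    have h1 := he {x | x.1 ∈ B}
    have h2 : Subtype.val '' {x : (matrixMatroid P₀ A₀ hA₀).E | x.1 ∈ B} = B := by
      ext x
      exact ⟨fun ⟨y, hy, h⟩ => h ▸ hy, fun hx => ⟨⟨x, Set.mem_univ x⟩, hx, rfl⟩⟩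
    have h3 : Subtype.val '' (e '' {x : (matrixMatroid P₀ A₀ hA₀).E | x.1 ∈ B}) = s '' B := by
      ext x
      constructor
      · rintro ⟨_, ⟨y, hy, rfl⟩, rfl⟩
        exact ⟨y, hy, rfl⟩
      · rintro ⟨y, hy, rfl⟩
        exact ⟨_, ⟨⟨y, Set.mem_univ y⟩, hy, rfl⟩, rfl⟩
    rw [h2, h3] at h1
    rw [matrixMatroid_isBase_iff, matrixMatroid_isBase_iff, hφ,
      MatrixMatroid.isMatrixBase_iff (A.map φ), Set.ncard_image_of_injective _ hs,
      Fintype.card_fin] at h1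
    rw [h1]
    refine and_congr_left fun _ => ?_
    exact ⟨fun h => h.comp_of_image hs.injOn, fun h => h.image_of_comp s _⟩
  obtain ⟨hX, hp⟩ := (hv (Set.range Sum.inl)).1 (Or.inl rfl)
  rw [← Set.image_univ, Set.ncard_image_of_injective _ Sum.inl_injective, Set.ncard_univ,
    Nat.card_eq_fintype_card] at hp
  rw [linearIndepOn_range_iff Sum.inl_injective] at hX
  by_cases hm : IsEmpty m
  · refine ⟨fun i => isEmptyElim i, fun k f g => ?_⟩
    have : IsEmpty (Fin k) := ⟨fun a => isEmptyElim (f a)⟩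
    simp
  rw [not_isEmpty_iff] at hm
  let b := basisOfLinearIndependentOfCardEqFinrank hX (by simp [hp])
  have hb : ∀ i, b i = v (Sum.inl i) := fun i => by simp [b]
  -- Coordinates with respect to the vectors labelled by `m` bring the representation to the form [I
  -- | A'].
  let A' : Matrix m n F := Matrix.of fun i j => b.equivFun (v (Sum.inr j)) i
  have hcol : MatrixMatroid.col A' = b.equivFun ∘ v := by
    funext x
    rcases x with i | j
    · change Pi.single i 1 = b.equivFun (v (Sum.inl i))
      rw [← hb]
      ext a
      simp [Pi.single_apply, eq_comm]
    · rfl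
  have hcol' : ∀ B, LinearIndepOn F (MatrixMatroid.col A') B ↔ LinearIndepOn F v B := by
    intro B
    rw [hcol]
    exact LinearMap.linearIndependent_iff_of_injOn b.equivFun.toLinearMap
      b.equivFun.injective.injOn
  refine ⟨A', fun k f g => ⟨fun h => ?_, fun h => ?_⟩⟩
  · have h1 := (MatrixMatroid.isMatrixBase_iff A' _).1 (Or.inr ⟨k, f, g, h, rfl⟩)
    rw [hcol', hp, ← hv, MatrixMatroid.isMatrixBase_iff] at h1
    exact (MatrixMatroid.linearIndepOn_iff_det A₀ f g).1 h1.1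
  · rw [← MatrixMatroid.linearIndepOn_iff_det, hcol']
    exact ((hv _).1 (Or.inr ⟨k, f, g, h, rfl⟩)).1

namespace Matrix

/-- Two matrices have the same vanishing subdeterminants. -/
def SameZeroMinors {R S m n : Type*} [CommRing R] [CommRing S] (A : Matrix m n R)
    (B : Matrix m n S) : Prop :=
  ∀ (k : ℕ) (f : Fin k ↪ m) (g : Fin k ↪ n),
    (A.submatrix f g).det ≠ 0 ↔ (B.submatrix f g).det ≠ 0

variable {R S m n : Type*} [CommRing R] [CommRing S] {A : Matrix m n R} {B : Matrix m n S}

theorem SameZeroMinors.apply_eq_zero_iff (h : A.SameZeroMinors B) (i : m) (j : n) :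
    A i j = 0 ↔ B i j = 0 := by
  have := h 1 ⟨fun _ => i, fun _ _ _ => Subsingleton.elim _ _⟩
    ⟨fun _ => j, fun _ _ _ => Subsingleton.elim _ _⟩
  rw [det_fin_one, det_fin_one] at this
  exact not_iff_not.1 this

theorem SameZeroMinors.det_eq_zero (h : A.SameZeroMinors B) {k : ℕ} {f : Fin k → m}
    {g : Fin k → n} (hf : Function.Injective f) (hg : Function.Injective g)
    (h0 : (B.submatrix f g).det = 0) : (A.submatrix f g).det = 0 := by
  by_contra hA
  exact (h k ⟨f, hf⟩ ⟨g, hg⟩).1 hA h0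

/-- A vanishing 2 × 2 minor is a multiplicative relation, which determines an entry from three
nonzero ones. -/
theorem SameZeroMinors.mul_eq_mul (h : A.SameZeroMinors B) {i i' : m} {j j' : n}
    (hi : i ≠ i') (hj : j ≠ j') (h0 : B i j * B i' j' = B i j' * B i' j) :
    A i j * A i' j' = A i j' * A i' j := by
  have := h.det_eq_zero (f := ![i, i']) (g := ![j, j'])
    (injective_pair_iff_ne.2 hi)
    (injective_pair_iff_ne.2 hj)
    (by rw [det_fin_two]; simp [h0])
  rw [det_fin_two] at this
  simpa [sub_eq_zero] using this

theorem SameZeroMinors.scale {F : Type*} [Field F] {A : Matrix m n F}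
    (h : A.SameZeroMinors B) (r : m → F) (c : n → F) (hr : ∀ i, r i ≠ 0) (hc : ∀ j, c j ≠ 0) :
    (of fun i j => r i * A i j * c j).SameZeroMinors B := by
  intro k f g
  rw [← h k f g]
  have : (of fun i j => r i * A i j * c j).submatrix f g
      = of fun i j => c (g j) * (of fun i j => r (f i) * A.submatrix f g i j) i j := by
    ext i j
    simp [mul_comm, mul_left_comm]
  rw [this, det_mul_row, det_mul_column]
  simp [Finset.prod_eq_zero_iff, hr, hc]

end Matrix

/-- After scaling, the vanishing minors of `matrixN₄` force the entries of one 5 × 5 block to be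
those of `liftOne`. That block has determinant -3, which is zero over GF(3) but not over `F`. -/
theorem not_sameZeroMinors_matrixN₄ {F : Type*} [Field F] (h3 : (3 : F) ≠ 0)
    (A : Matrix (Fin 8) (Fin 8) F) : ¬ A.SameZeroMinors matrixN₄ := by
  intro hA
  obtain ⟨A, hA, h0, h1, h14, h41⟩ : ∃ A : Matrix (Fin 8) (Fin 8) F, A.SameZeroMinors matrixN₄ ∧
      (∀ j, j ≠ 1 → A 0 j = 1) ∧ (∀ i, i ≠ 1 → A i 0 = 1) ∧ A 1 4 = 1 ∧ A 4 1 = 1 := by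
    have ha : ∀ i j, matrixN₄ i j ≠ 0 → A i j ≠ 0 := fun i j => (hA.apply_eq_zero_iff i j).not.2
    have hr0 : ∀ j, j ≠ 1 → A 0 j ≠ 0 := fun j hj => ha 0 j (by revert j; decide +kernel)
    have hc0 : ∀ i, i ≠ 1 → A i 0 ≠ 0 := fun i hi => ha i 0 (by revert i; decide +kernel)
    have a14 : A 1 4 ≠ 0 := ha 1 4 (by decide +kernel)
    have a41 : A 4 1 ≠ 0 := ha 4 1 (by decide +kernel)
    -- The scaling makes the entries of a spanning tree equal to 1: row 0 and column 0 reach all but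
    -- row 1 and column 1, which are attached through the entries (1, 4) and (4, 1).
    let r : Fin 8 → F := fun i => if i = 1 then A 0 4 / A 1 4 else A 0 0 / A i 0
    let c : Fin 8 → F := fun j => if j = 1 then A 4 0 / (A 0 0 * A 4 1) else 1 / A 0 j
    have a00 := hr0 0 (by decide)
    have a04 := hr0 4 (by decide)
    have a40 := hc0 4 (by decide)
    refine ⟨_, hA.scale r c ?_ ?_, ?_, ?_, ?_, ?_⟩
    · intro i
      by_cases hi : i = 1
      · simp [r, hi, a04, a14]
      · simp [r, hi, a00, hc0 i hi]
    · intro j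
      by_cases hj : j = 1
      · simp [c, hj, a40, a00, a41]
      · simp [c, hj, hr0 j hj]
    · intro j hj
      have := hr0 j hj
      simp [r, c, hj, a00, this]
    · intro i hi
      have := hc0 i hi
      simp [r, c, hi]
      field_simp
    · simp [r, c]
      field_simp
    · simp [r, c]
      field_simp
  have two : ∀ i i' j j', i ≠ i' → j ≠ j' →
      matrixN₄ i j * matrixN₄ i' j' = matrixN₄ i j' * matrixN₄ i' j →
      A i j * A i' j' = A i j' * A i' j := fun i i' j j' hi hj => hA.mul_eq_mul hi hj
  have z : ∀ i j, matrixN₄ i j = 0 → A i j = 0 := fun i j => (hA.apply_eq_zero_iff i j).2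
  have a00 := h0 0 (by decide)
  have a02 := h0 2 (by decide)
  have a03 := h0 3 (by decide)
  have a04 := h0 4 (by decide)
  have a05 := h0 5 (by decide)
  have a06 := h0 6 (by decide)
  have a07 := h0 7 (by decide)
  have a20 := h1 2 (by decide)
  have a30 := h1 3 (by decide)
  have a40 := h1 4 (by decide)
  have a50 := h1 5 (by decide)
  have a60 := h1 6 (by decide)
  have a70 := h1 7 (by decide)
  have a11 : A 1 1 = -1 := by
    have := hA.det_eq_zero (f := ![0, 1, 4]) (g := ![0, 1, 4]) (by decide) (by decide)
      (by decide +kernel)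
    rw [Matrix.det_fin_three] at this
    simp [a00, a04, a40, h14, h41, z 0 1 rfl, z 1 0 rfl, z 4 4 rfl] at this
    linear_combination -this
  have a75 : A 7 5 = 1 := by
    have := two 0 7 0 5 (by decide) (by decide) (by decide +kernel)
    rw [a00, a05, a70] at this
    linear_combination this
  have a55 : A 5 5 = 1 := by
    have := two 0 5 0 5 (by decide) (by decide) (by decide +kernel)
    rw [a00, a05, a50] at this
    linear_combination this
  have a57 : A 5 7 = 1 := by
    have := two 0 5 0 7 (by decide) (by decide) (by decide +kernel)
    rw [a00, a07, a50] at this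
    linear_combination this
  have a23 : A 2 3 = 1 := by
    have := two 0 2 0 3 (by decide) (by decide) (by decide +kernel)
    rw [a00, a03, a20] at this
    linear_combination this
  have a26 : A 2 6 = 1 := by
    have := two 0 2 0 6 (by decide) (by decide) (by decide +kernel)
    rw [a00, a06, a20] at this
    linear_combination this
  have a32 : A 3 2 = 1 := by
    have := two 0 3 0 2 (by decide) (by decide) (by decide +kernel)
    rw [a00, a02, a30] at this
    linear_combination this
  have a67 : A 6 7 = A 6 3 := by
    have := two 0 6 3 7 (by decide) (by decide) (by decide +kernel)
    rw [a03, a07] at this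
    linear_combination this
  have a66 : A 6 6 = A 6 3 := by
    have := two 0 6 3 6 (by decide) (by decide) (by decide +kernel)
    rw [a03, a06] at this
    linear_combination this
  have a36 : A 3 6 = A 6 3 := by
    have := two 3 6 0 6 (by decide) (by decide) (by decide +kernel)
    rw [a30, a66, a60] at this
    linear_combination -this
  have a76 : A 7 6 = A 6 3 := by
    have := two 3 7 0 6 (by decide) (by decide) (by decide +kernel)
    rw [a30, a36, a70] at this
    linear_combination this
  -- With x = `A 6 3` this block has determinant -x² - x, and x is nonzero.
  have a63 : A 6 3 = -1 := by
    have := hA.det_eq_zero (f := ![5, 6, 7]) (g := ![5, 6, 7]) (by decide) (by decide)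
      (by decide +kernel)
    rw [Matrix.det_fin_three] at this
    simp [a55, a57, a66, a67, a75, a76, z 5 6 rfl, z 6 5 rfl, z 7 7 rfl] at this
    have h63 : A 6 3 ≠ 0 := (hA.apply_eq_zero_iff 6 3).not.2 (by decide +kernel)
    refine mul_left_cancel₀ h63 ?_
    linear_combination -this
  have a22 : A 2 2 = -1 := by
    have := two 2 3 2 6 (by decide) (by decide) (by decide +kernel)
    rw [a36, a26, a32, a63] at this
    linear_combination -this
  -- All entries of this block are now known integers, so its determinant can be computed over ℤ.
  have := hA.det_eq_zero (f := ![0, 1, 2, 3, 4]) (g := ![0, 1, 2, 3, 4]) (by decide) (by decide)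
    (by decide +kernel)
  have hsub : A.submatrix ![0, 1, 2, 3, 4] ![0, 1, 2, 3, 4]
      = (!![1, 0, 1, 1, 1; 0, -1, 0, 0, 1; 1, 0, -1, 1, 0; 1, 0, 1, 0, 0; 1, 1, 0, 0, 0] :
        Matrix (Fin 5) (Fin 5) ℤ).map (Int.castRingHom F) := by
    ext i j
    fin_cases i <;> fin_cases j <;>
      simp [a00, a02, a03, a04, a11, h14, a20, a22, a23, a30, a32, a40, h41, z 0 1 rfl, z 1 0 rfl,
        z 1 2 rfl, z 1 3 rfl, z 2 1 rfl, z 2 4 rfl, z 3 1 rfl, z 3 3 rfl, z 3 4 rfl, z 4 2 rfl,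
        z 4 3 rfl, z 4 4 rfl]
  have hdet : (!![1, 0, 1, 1, 1; 0, -1, 0, 0, 1; 1, 0, -1, 1, 0; 1, 0, 1, 0, 0; 1, 1, 0, 0, 0] :
      Matrix (Fin 5) (Fin 5) ℤ).det = -3 := by decide +kernel
  rw [hsub, ← RingHom.mapMatrix_apply, ← RingHom.map_det, hdet] at this
  exact h3 (by simpa using this)

theorem not_isDyadic_N₄ : ¬ IsDyadic N₄ := by
  intro h
  have h3 : (3 : ZMod 5) ≠ 0 := by decide
  have h2 : IsUnit (Int.castRingHom (ZMod 5) 2) := ⟨⟨2, 3, by decide, by decide⟩, rfl⟩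
  have : Fact (Nat.Prime 5) := ⟨by norm_num⟩
  -- GF(5) serves because 2 is invertible there and 3 is nonzero.
  let φ : Localization.Away (2 : ℤ) →+* ZMod 5 := IsLocalization.Away.lift 2 h2
  obtain ⟨A, hA⟩ := exists_matrix_of_isRepresentableOver (F := ZMod 5) φ matrixN₄ h
  exact not_sameZeroMinors_matrixN₄ h3 A hA

/-! ### Size, rank and the conclusion -/

theorem MatroidIso.encard_ground_eq {α β : Type*} {M : Matroid α} {N : Matroid β}
    (h : MatroidIso M N) : M.E.encard = N.E.encard := by
  obtain ⟨e, -⟩ := h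
  exact Set.encard_congr e

theorem encard_ground_N₄ : N₄.E.encard = 16 := by
  change (Set.univ : Set (Fin 8 ⊕ Fin 8)).encard = 16
  rw [Set.encard_univ]
  simp

theorem eRank_N₄ : N₄.eRank = 8 := by
  have h : N₄.IsBase (Set.range Sum.inl) := Or.inl rfl
  rw [← h.encard_eq_eRank, ← Set.image_univ, Sum.inl_injective.encard_image, Set.encard_univ]
  simp

theorem MatroidIso.refl {α : Type*} (M : Matroid α) : MatroidIso M M :=
  ⟨Equiv.refl _, fun B => by rw [Equiv.coe_refl, Set.image_id]⟩

theorem isDyadicExcludedMinor_N₄ : IsDyadicExcludedMinor N₄ :=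
  ⟨⟨Set.toFinite _⟩, not_isDyadic_N₄, fun _ h => isDyadic_of_isStrictMinor_N₄ h⟩

theorem not_matroidIso_N₄ {β : Type*} {N : Matroid β} (hN : N.E.encard ≤ 15) :
    ¬ MatroidIso N₄ N := by
  intro h
  rw [← h.encard_ground_eq, encard_ground_N₄] at hN
  exact absurd hN (by decide)

theorem mainTheorem3 :
    -- `N₄` is a ternary matroid with 16 elements and rank 8
    N₄.E.encard = 16 ∧ N₄.eRank = 8 ∧ IsRepresentableOver PartialField.gf3 N₄ ∧
    -- `N₄` is an excluded minor for the class of dyadic matroids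
    IsDyadicExcludedMinor N₄ ∧
    -- no list of matroids with at most 15 elements contains, up to isomorphism, all the excluded
    -- minors for the class of dyadic matroids; indeed `N₄` is missing from any such list
    (∀ L : Set (Σ α : Type, Matroid α), (∀ N ∈ L, N.2.E.encard ≤ 15) →
      (∀ N ∈ L, ¬ MatroidIso N₄ N.2) ∧
      ¬ ∀ (α : Type) (M : Matroid α), IsDyadicExcludedMinor M → ∃ N ∈ L, MatroidIso M N.2) := by
  refine ⟨encard_ground_N₄, eRank_N₄,
    ⟨8, 8, matrixN₄, PartialField.ofField_isPMatrix _, MatroidIso.refl _⟩,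
    isDyadicExcludedMinor_N₄, fun L hL => ⟨fun N hN => not_matroidIso_N₄ (hL N hN), fun h => ?_⟩⟩
  obtain ⟨N, hN, hiso⟩ := h _ N₄ isDyadicExcludedMinor_N₄
  exact not_matroidIso_N₄ (hL N hN) hiso
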